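/- **Setting.** A *box space of graphs* is a disjoint union $X=\bigsqcup_{i\in\mathbb N}X_i$ of finite (simple, not necessarily connected) graphs of uniformly bounded degree with $|X_i|\to\infty$, with the metric $d$ that is the graph metric on each connected component and $\infty$ between different components. Let $\beta X$ be the Stone–Čech compactification of the discrete set $X$ and $\partial\beta X=\beta X\setminus X$; for $A\subseteq X$ put $\partial\beta A=\overline A\setminus X$. With $E_R=\{(x,y)\in X\times X: d(x,y)\le R\}$, the *coarse groupoid* is $G(X)=\bigcup_{R>0}\overline{E_R}\subseteq\beta X\times\beta X$ (closures in $\beta X\times\beta X$), with the weak topology of this union and the operations of the pair groupoid. For a closed invariant $Z\subseteq\beta X$ let $G(X)|_Z$ be the reduction, $C_c(G(X)|_Z)$ the $*$-algebra of continuous compactly supported functions under convolution and $f^*(g)=\overline{f(g^{-1})}$, and $C^*_{\max}(G(X)|_Z)$ its completion in the norm $\|T\|=\sup_\pi\|\pi(T)\|$ over all unital $*$-representations $\pi$ on Hilbert spaces. The *Laplace operator* $\Delta\in C^*_{\max}(G(X)|_Z)$ is the element of $C_c(G(X)|_Z)$ obtained from the matrix $\Delta_{xx}=\deg(x)$, $\Delta_{xy}=-1$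 if $x\sim y$, $\Delta_{xy}=0$ otherwise, by continuous extension to $G(X)$ and restriction to $G(X)|_Z$. Given $Y_i\subseteq X_i$ with $|Y_i|/|X_i|\to1$ and $Y=\bigcup_iY_i$, the *core* of $Y$ is $$\mathrm{core}(Y)=\partial\beta X\setminus\mathrm{sat}(\partial\beta(X\setminus Y)),\qquad \mathrm{sat}(A)=\{x\in\beta X:(a,x)\in G(X)\text{ for some }a\in A\}.$$ It is a closed invariant set. The box space $X$ has *almost boundary (T)* if there are $Y_i\subseteq X_i$ with $|Y_i|/|X_i|\to1$ and a constant $c>0$ such that, for $Z=\mathrm{core}(Y)$, the spectrum of $\Delta$ in $C^*_{\max}(G(X)|_Z)$ is contained in $\{0\}\cup[c,\infty)$. Box spaces $X=\bigsqcup_iX_i$ and $X'=\bigsqcup_iX_i'$ are *approximately isomorphic* if there are (not necessarily induced) subgraphs $Y_i\subseteq X_i$ and $Y_i'\subseteq X_i'$ with $Y_i\cong Y_i'$ as graphs for every $i$ and $$\lim_{i\to\infty}\frac{|Y_i|}{|X_i|}=\lim_{i\to\infty}\frac{|Y_i'|}{|X_i'|}=\lim_{i\to\infty}\frac{|E(Y_i)|}{|E(X_i)|}=\lim_{i\to\infty}\frac{|E(Y_i')|}{|E(X_i')|}=1,$$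 where a quotient of edge numbers is read as $1$ if the denominator is $0$. **Proposition.** Let $X=\bigsqcup_iX_i$ and $X'=\bigsqcup_iX'_i$ be box spaces of graphs that are approximately isomorphic. If $X'$ has almost boundary (T), then so does $X$. -/

import Mathlib

open Filter Topology Set
open scoped ENNReal CompactlySupported

universe u

/-- A box space of graphs: a sequence of finite (simple, not necessarily connected) graphs of
uniformly bounded degree whose numbers of vertices tend to infinity. -/
structure BoxSpace : Type (u + 1) where
  /-- The vertex sets. -/
  V : ℕ → Type u
  finite : ∀ i, Finite (V i)
  /-- The graphs. -/
  graph : ∀ i, SimpleGraph (V i)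
  bounded_degree : ∃ d : ℕ, ∀ i x, ((graph i).neighborSet x).ncard ≤ d
  card_tendsto : Tendsto (fun i => Nat.card (V i)) atTop atTop

namespace BoxSpace

variable (X : BoxSpace.{u})

/-- The underlying set of the disjoint union. -/
abbrev Pt : Type u := Σ i, X.V i

/-- The disjoint union of the graphs. -/
def total : SimpleGraph X.Pt where
  Adj p q := ∃ i x y, p = ⟨i, x⟩ ∧ q = ⟨i, y⟩ ∧ (X.graph i).Adj x y
  symm := ⟨by
    rintro p q ⟨i, x, y, hp, hq, h⟩
    exact ⟨i, y, x, hq, hp, h.symm⟩⟩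
  loopless := ⟨by
    rintro p ⟨i, x, y, hp, hq, h⟩
    subst hp
    obtain rfl : x = y := by simpa using hq
    exact h.ne rfl⟩

/-- The metric of the box space: the graph metric on each connected component, and `⊤` between
different components. -/
noncomputable def dist (p q : X.Pt) : ℕ∞ := X.total.edist p q

/-- The set `E_R` of pairs at distance at most `R`. As distances are natural numbers or infinite,
it is enough to consider `R : ℕ`. -/
def entourage (R : ℕ) : Set (X.Pt × X.Pt) := {p | X.dist p.1 p.2 ≤ R}

/-- The Stone-Čech compactification of the discrete space of all vertices, as the space of
ultrafilters; a vertex `x` is the principal ultrafilter `pure x`. -/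
abbrev StoneCech : Type u := Ultrafilter X.Pt

/-- The closure of `E_R` in `βX × βX`. -/
def entClosure (R : ℕ) : Set (X.StoneCech × X.StoneCech) :=
  closure ((fun p : X.Pt × X.Pt => ((pure p.1 : X.StoneCech), (pure p.2 : X.StoneCech))) ''
    X.entourage R)

/-- The coarse groupoid `G(X)`, the union of the closures of the `E_R`, with the operations of the
pair groupoid `βX × βX`. -/
def CoarseGroupoid : Type u := {g : X.StoneCech × X.StoneCech // ∃ R, g ∈ X.entClosure R}

namespace CoarseGroupoid

variable {X}

/-- The range of an arrow. -/
def range (g : X.CoarseGroupoid) : X.StoneCech := g.1.1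

/-- The source of an arrow. -/
def source (g : X.CoarseGroupoid) : X.StoneCech := g.1.2

end CoarseGroupoid

/-- The inclusion of the closure of `E_R` into the coarse groupoid. -/
def entIncl (R : ℕ) (g : X.entClosure R) : X.CoarseGroupoid := ⟨g.1, R, g.2⟩

/-- The weak topology of the union: a set is open iff its intersection with the closure of every
`E_R` is open there. -/
instance : TopologicalSpace X.CoarseGroupoid :=
  ⨆ R, TopologicalSpace.coinduced (X.entIncl R) inferInstance

/-- A closed invariant subset of the base space `βX` of the coarse groupoid. -/
structure InvSet where
  /-- The underlying set. -/
  carrier : Set X.StoneCech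
  isClosed : IsClosed carrier
  invariant : ∀ g : X.CoarseGroupoid, g.source ∈ carrier ↔ g.range ∈ carrier

variable {X}

/-- The reduction `G(X)|_Z` of the coarse groupoid, with the subspace topology. -/
def Reduction (Z : X.InvSet) : Type u :=
  {g : X.CoarseGroupoid // g.range ∈ Z.carrier ∧ g.source ∈ Z.carrier}

instance (Z : X.InvSet) : TopologicalSpace (Reduction Z) :=
  inferInstanceAs (TopologicalSpace {_g : X.CoarseGroupoid // _})

/-- The set `C_c(G(X)|_Z)`. It is a type of its own, since its product is the convolution and not
the pointwise product. -/
def ConvAlg (Z : X.InvSet) : Type u := C_c(Reduction Z, ℂ)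

noncomputable instance (Z : X.InvSet) : AddCommGroup (ConvAlg Z) :=
  inferInstanceAs (AddCommGroup C_c(Reduction Z, ℂ))

noncomputable instance (Z : X.InvSet) : Module ℂ (ConvAlg Z) :=
  inferInstanceAs (Module ℂ C_c(Reduction Z, ℂ))

/-- The underlying function of an element of `C_c(G(X)|_Z)`. -/
noncomputable def ConvAlg.fn {Z : X.InvSet} (f : ConvAlg Z) (g : Reduction Z) : ℂ :=
  CompactlySupportedContinuousMap.toContinuousMap f g

open Classical in
/-- A function on `G(X)|_Z`, extended by zero to `βX × βX`. -/
noncomputable def ConvAlg.ext {Z : X.InvSet} (f : ConvAlg Z) (ω η : X.StoneCech) : ℂ :=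
  if h : (∃ R, (ω, η) ∈ X.entClosure R) ∧ ω ∈ Z.carrier ∧ η ∈ Z.carrier then
    f.fn ⟨⟨(ω, η), h.1⟩, h.2⟩ else 0

/-! ### Bounded geometry -/

lemma adj_iff (i : ℕ) (x : X.V i) (q : X.Pt) :
    X.total.Adj ⟨i, x⟩ q ↔ ∃ y, q = ⟨i, y⟩ ∧ (X.graph i).Adj x y := by
  constructor
  · rintro ⟨j, x', y, hp, hq, h⟩
    obtain ⟨rfl, h2⟩ := Sigma.mk.inj_iff.1 hp
    obtain rfl := eq_of_heq h2
    exact ⟨y, hq, h⟩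
  · rintro ⟨y, hq, h⟩
    exact ⟨i, x, y, rfl, hq, h⟩

lemma exists_degree_bound (X : BoxSpace.{u}) : ∃ d : ℕ, ∀ p : X.Pt,
    (X.total.neighborSet p).Finite ∧ (X.total.neighborSet p).ncard ≤ d := by
  obtain ⟨d, hd⟩ := X.bounded_degree
  refine ⟨d, ?_⟩
  rintro ⟨i, x⟩
  have := X.finite i
  have : X.total.neighborSet ⟨i, x⟩ = Sigma.mk i '' (X.graph i).neighborSet x := by
    ext q
    simp only [SimpleGraph.mem_neighborSet, adj_iff, Set.mem_image]
    constructor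
    · rintro ⟨y, rfl, h⟩
      exact ⟨y, h, rfl⟩
    · rintro ⟨y, h, rfl⟩
      exact ⟨y, rfl, h⟩
  rw [this]
  exact ⟨(Set.toFinite _).image _, (Set.ncard_image_le (Set.toFinite _)).trans (hd i x)⟩

lemma dist_self (x : X.Pt) : X.dist x x = 0 := SimpleGraph.edist_self

lemma dist_comm (x y : X.Pt) : X.dist x y = X.dist y x := SimpleGraph.edist_comm

lemma dist_triangle (x y z : X.Pt) : X.dist x z ≤ X.dist x y + X.dist y z :=
  SimpleGraph.edist_triangle

lemma dist_add {x y z : X.Pt} {R S : ℕ} (h : X.dist x y ≤ R) (h' : X.dist y z ≤ S) :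
    X.dist x z ≤ (R + S : ℕ) := by
  push_cast
  exact (dist_triangle x y z).trans (add_le_add h h')

lemma exists_step {x y : X.Pt} {R : ℕ} (h : X.dist x y ≤ (R + 1 : ℕ)) :
    x = y ∨ ∃ z, X.total.Adj x z ∧ X.dist z y ≤ R := by
  obtain ⟨w, hw⟩ := SimpleGraph.exists_walk_of_edist_ne_top
    (ne_top_of_le_ne_top (ENat.natCast_ne_top _) h)
  have hl : w.length ≤ R + 1 := by
    have : (w.length : ℕ∞) ≤ (R + 1 : ℕ) := hw.trans_le h
    exact_mod_cast this
  cases w with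
  | nil => exact Or.inl rfl
  | cons h' w' =>
    refine Or.inr ⟨_, h', (SimpleGraph.edist_le w').trans ?_⟩
    simp only [SimpleGraph.Walk.length_cons] at hl
    exact_mod_cast (by omega : w'.length ≤ R)

lemma exists_ball_bound (X : BoxSpace.{u}) (R : ℕ) : ∃ N : ℕ, ∀ x : X.Pt,
    {y | X.dist x y ≤ R}.Finite ∧ {y | X.dist x y ≤ R}.ncard ≤ N := by
  obtain ⟨d, hd⟩ := exists_degree_bound X
  induction R with
  | zero =>
    refine ⟨1, fun x => ?_⟩
    have : {y | X.dist x y ≤ (0 : ℕ)} = {x} := by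
      ext y
      simp only [Nat.cast_zero, nonpos_iff_eq_zero, Set.mem_ofPred_eq, Set.mem_singleton_iff]
      exact SimpleGraph.edist_eq_zero_iff.trans eq_comm
    rw [this]
    simp
  | succ R ih =>
    obtain ⟨N, hN⟩ := ih
    refine ⟨1 + d * N, fun x => ?_⟩
    have hsub : {y | X.dist x y ≤ (R + 1 : ℕ)} ⊆
        {x} ∪ ⋃ z ∈ (hd x).1.toFinset, {y | X.dist z y ≤ R} := by
      intro y hy
      rcases exists_step hy with rfl | ⟨z, hz, hzy⟩
      · simp
      · right
        simp only [Set.mem_iUnion]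
        exact ⟨z, by simpa using hz, hzy⟩
    have hfin : (⋃ z ∈ (hd x).1.toFinset, {y | X.dist z y ≤ R}).Finite :=
      Set.Finite.biUnion (Finset.finite_toSet _) fun z _ => (hN z).1
    have hfin2 := (Set.finite_singleton x).union hfin
    refine ⟨hfin2.subset hsub, (Set.ncard_le_ncard hsub hfin2).trans ?_⟩
    refine (Set.ncard_union_le _ _).trans ?_
    rw [Set.ncard_singleton]
    gcongr
    refine (Finset.set_ncard_biUnion_le _ _).trans ?_
    refine (Finset.sum_le_card_nsmul _ _ N fun z _ => (hN z).2).trans ?_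
    rw [smul_eq_mul]
    gcongr
    rw [← Set.ncard_eq_toFinset_card _ (hd x).1]
    exact (hd x).2

lemma exists_coloring (X : BoxSpace.{u}) (R : ℕ) : ∃ (k : ℕ) (c : X.Pt → Fin k),
    ∀ x y, x ≠ y → X.dist x y ≤ R → c x ≠ c y := by
  obtain ⟨N, hN⟩ := exists_ball_bound X R
  have := X.finite
  obtain ⟨e, he⟩ := Countable.exists_injective_nat X.Pt
  have key : ∀ n : ℕ, ∀ x : X.Pt, ∀ c : ∀ y, e y < e x → Fin (N + 1),
      ∃ a : Fin (N + 1), ∀ y (h : e y < e x), X.dist x y ≤ R → c y h ≠ a := by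
    intro _ x c
    by_contra hcon
    push Not at hcon
    choose y hy hd hc using hcon
    have hinj : Function.Injective y := by
      intro a b hab
      rw [← hc a, ← hc b]
      congr 1
    have h1 := Set.ncard_le_ncard (s := Set.range y) (t := {y | X.dist x y ≤ R})
      (by rintro _ ⟨a, rfl⟩; exact hd a) (hN x).1
    have h2 : (Set.range y).ncard = N + 1 := by
      rw [← Set.image_univ, Set.ncard_image_of_injective _ hinj, Set.ncard_univ]
      simp
    have := (hN x).2
    omega
  choose g hg using key 0
  let wf : WellFounded fun x y : X.Pt => e x < e y := (measure e).wf
  let c : X.Pt → Fin (N + 1) := wf.fix g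
  have hc : ∀ x y, e y < e x → X.dist x y ≤ R → c y ≠ c x := by
    intro x y hxy hd
    have : c x = g x fun y _ => c y := wf.fix_eq g x
    rw [this]
    exact hg x (fun y _ => c y) y hxy hd
  refine ⟨N + 1, c, fun x y hne hd => ?_⟩
  rcases lt_trichotomy (e x) (e y) with h | h | h
  · exact hc y x h (by rwa [dist_comm])
  · exact absurd (he h) hne
  · exact (hc x y h hd).symm

/-- A finite family of maps of displacement at most `R` that covers `E_R`, separated by
a colouring of the points. -/
structure Sections (X : BoxSpace.{u}) (R : ℕ) where
  /-- The number of colours. -/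
  k : ℕ
  /-- The colouring. -/
  col : X.Pt → Fin k
  /-- The maps. -/
  t : Fin k → X.Pt → X.Pt
  near : ∀ b x, X.dist x (t b x) ≤ R
  eq : ∀ x y, X.dist x y ≤ R → t (col y) x = y

lemma exists_sections (X : BoxSpace.{u}) (R : ℕ) : Nonempty (Sections X R) := by
  classical
  obtain ⟨k, c, hc⟩ := exists_coloring X (R + R)
  refine ⟨⟨k, c, fun b x => if h : ∃ y, c y = b ∧ X.dist x y ≤ R then h.choose else x, ?_, ?_⟩⟩
  · intro b x
    split_ifs with h
    · exact h.choose_spec.2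
    · rw [dist_self]
      exact zero_le
  · intro x y hxy
    have h : ∃ z, c z = c y ∧ X.dist x z ≤ R := ⟨y, rfl, hxy⟩
    rw [dif_pos h]
    by_contra hne
    refine hc _ _ hne (dist_add ?_ hxy) h.choose_spec.1
    rw [dist_comm]
    exact h.choose_spec.2

/-! ### Pairs of points of the compactification as ultrafilters of pairs -/

/-- The pair of points of `βX` given by an ultrafilter of pairs. -/
def proj (U : Ultrafilter (X.Pt × X.Pt)) : X.StoneCech × X.StoneCech :=
  (U.map Prod.fst, U.map Prod.snd)

lemma continuous_umap {α β : Type*} (f : α → β) :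
    Continuous fun U : Ultrafilter α => U.map f := by
  refine ultrafilterBasis_is_basis.continuous_iff.2 ?_
  rintro _ ⟨s, rfl⟩
  exact ultrafilter_isOpen_basic (f ⁻¹' s)

lemma continuous_proj : Continuous (proj (X := X)) :=
  (continuous_umap _).prodMk (continuous_umap _)

lemma mem_entClosure {R : ℕ} {g : X.StoneCech × X.StoneCech} :
    g ∈ X.entClosure R ↔ ∃ U, X.entourage R ∈ U ∧ proj U = g := by
  constructor
  · have hcl : IsClosed (proj '' {U : Ultrafilter (X.Pt × X.Pt) | X.entourage R ∈ U}) :=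
      ((ultrafilter_isClosed_basic _).isCompact.image continuous_proj).isClosed
    intro h
    refine closure_minimal ?_ hcl h
    rintro _ ⟨p, hp, rfl⟩
    exact ⟨pure p, hp, rfl⟩
  · rintro ⟨U, hU, rfl⟩
    refine mem_closure_of_tendsto
      ((continuous_proj.tendsto U).comp (Ultrafilter.tendsto_pure_self U)) ?_
    filter_upwards [hU] with p hp
    exact ⟨p, hp, rfl⟩

lemma mem_entourage {R : ℕ} {p : X.Pt × X.Pt} : p ∈ X.entourage R ↔ X.dist p.1 p.2 ≤ R := Iff.rfl

lemma entourage_mem_map {α : Type*} {ω : Ultrafilter α} {R : ℕ} {f : α → X.Pt × X.Pt}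
    (h : ∀ x, X.dist (f x).1 (f x).2 ≤ R) : X.entourage R ∈ ω.map f :=
  Ultrafilter.mem_map.2 (Filter.univ_mem' h)

lemma entourage_mono {R S : ℕ} (h : R ≤ S) : X.entourage R ⊆ X.entourage S := by
  intro p hp
  rw [mem_entourage] at hp ⊢
  exact hp.trans (by exact_mod_cast h)

lemma entClosure_mono {R S : ℕ} (h : R ≤ S) : X.entClosure R ⊆ X.entClosure S :=
  closure_mono (Set.image_mono (entourage_mono h))

namespace Sections

variable {R : ℕ} (σ : Sections X R)

lemma exists_col (η : X.StoneCech) : ∃ b, σ.col ⁻¹' {b} ∈ η := by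
  have : ∀ᶠ x in (η : Filter X.Pt), ∃ b, σ.col x = b := Eventually.of_forall fun x => ⟨_, rfl⟩
  exact Ultrafilter.eventually_exists_iff.1 this

lemma col_unique {η : X.StoneCech} {b c : Fin σ.k} (hb : σ.col ⁻¹' {b} ∈ η)
    (hc : σ.col ⁻¹' {c} ∈ η) : b = c := by
  obtain ⟨x, hx, hx'⟩ := η.nonempty_of_mem (inter_mem hb hc)
  exact hx.symm.trans hx'

lemma eq_map {U : Ultrafilter (X.Pt × X.Pt)} (hU : X.entourage R ∈ U) {b : Fin σ.k}
    (hb : σ.col ⁻¹' {b} ∈ U.map Prod.snd) :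
    U = (U.map Prod.fst).map fun x => (x, σ.t b x) := by
  rw [Ultrafilter.map_map]
  conv_lhs => rw [← Ultrafilter.map_id U]
  apply Ultrafilter.coe_injective
  rw [Ultrafilter.coe_map, Ultrafilter.coe_map]
  apply Filter.map_congr
  filter_upwards [hU, hb] with p hp hpb
  have : σ.col p.2 = b := hpb
  subst this
  exact Prod.ext rfl (σ.eq _ _ hp).symm

lemma snd_eq {U : Ultrafilter (X.Pt × X.Pt)} (hU : X.entourage R ∈ U) {b : Fin σ.k}
    (hb : σ.col ⁻¹' {b} ∈ U.map Prod.snd) :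
    U.map Prod.snd = (U.map Prod.fst).map (σ.t b) := by
  conv_lhs => rw [σ.eq_map hU hb]
  rw [Ultrafilter.map_map]
  rfl

lemma eq_of_mem {ω η : X.StoneCech} (h : (ω, η) ∈ X.entClosure R) {b : Fin σ.k}
    (hb : σ.col ⁻¹' {b} ∈ η) : η = ω.map (σ.t b) := by
  obtain ⟨U, hU, hp⟩ := mem_entClosure.1 h
  obtain ⟨rfl, rfl⟩ := Prod.mk.inj hp
  exact σ.snd_eq hU hb

lemma mem (ω : X.StoneCech) (b : Fin σ.k) : (ω, ω.map (σ.t b)) ∈ X.entClosure R := by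
  refine mem_entClosure.2 ⟨ω.map fun x => (x, σ.t b x), ?_, ?_⟩
  · exact entourage_mem_map fun x => σ.near b x
  · exact Prod.ext (by simp only [proj, Ultrafilter.map_map]; exact ω.map_id)
      (by simp only [proj, Ultrafilter.map_map]; rfl)

end Sections

lemma proj_injOn {R : ℕ} {U U' : Ultrafilter (X.Pt × X.Pt)} (hU : X.entourage R ∈ U)
    (hU' : X.entourage R ∈ U') (h : proj U = proj U') : U = U' := by
  obtain ⟨σ⟩ := exists_sections X R
  obtain ⟨h1, h2⟩ := Prod.mk.inj h
  obtain ⟨b, hb⟩ := σ.exists_col (U.map Prod.snd)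
  rw [σ.eq_map hU hb, σ.eq_map hU' (h2 ▸ hb), h1]

lemma entClosure_symm {R : ℕ} {ω η : X.StoneCech} (h : (ω, η) ∈ X.entClosure R) :
    (η, ω) ∈ X.entClosure R := by
  obtain ⟨U, hU, hp⟩ := mem_entClosure.1 h
  obtain ⟨rfl, rfl⟩ := Prod.mk.inj hp
  refine mem_entClosure.2 ⟨U.map Prod.swap, ?_, ?_⟩
  · rw [Ultrafilter.mem_map]
    filter_upwards [hU] with p hp
    rw [Set.mem_preimage, mem_entourage, Prod.fst_swap, Prod.snd_swap, dist_comm]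
    exact hp
  · simp only [proj, Ultrafilter.map_map]
    rfl

lemma entClosure_trans {R S : ℕ} {ω ζ η : X.StoneCech} (h : (ω, ζ) ∈ X.entClosure R)
    (h' : (ζ, η) ∈ X.entClosure S) : (ω, η) ∈ X.entClosure (R + S) := by
  obtain ⟨σ⟩ := exists_sections X R
  obtain ⟨τ⟩ := exists_sections X S
  obtain ⟨b, hb⟩ := σ.exists_col ζ
  obtain ⟨c, hc⟩ := τ.exists_col η
  obtain rfl := σ.eq_of_mem h hb
  obtain rfl := τ.eq_of_mem h' hc
  refine mem_entClosure.2 ⟨ω.map fun x => (x, τ.t c (σ.t b x)), ?_, ?_⟩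
  · exact entourage_mem_map fun x => dist_add (σ.near b x) (τ.near c _)
  · exact Prod.ext (by simp only [proj, Ultrafilter.map_map]; exact ω.map_id)
      (by simp only [proj, Ultrafilter.map_map]; rfl)

lemma entClosure_refl (R : ℕ) (ω : X.StoneCech) : (ω, ω) ∈ X.entClosure R := by
  refine mem_entClosure.2 ⟨ω.map fun x => (x, x), ?_, ?_⟩
  · refine entourage_mem_map fun x => ?_
    rw [dist_self]
    exact zero_le
  · exact Prod.ext (by simp only [proj, Ultrafilter.map_map]; exact ω.map_id)
      (by simp only [proj, Ultrafilter.map_map]; exact ω.map_id)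

/-! ### Topology of the reduction -/

lemma continuous_entIncl (R : ℕ) : Continuous (X.entIncl R) :=
  continuous_iSup_rng (i := R) continuous_coinduced_rng

lemma isClosed_groupoid_iff {s : Set X.CoarseGroupoid} :
    IsClosed s ↔ ∀ R, IsClosed (X.entIncl R ⁻¹' s) := by
  rw [isClosed_iSup_iff]
  exact forall_congr' fun R => isClosed_coinduced

lemma continuous_val : Continuous fun g : X.CoarseGroupoid => g.1 := by
  rw [continuous_iff_isClosed]
  intro s hs
  rw [isClosed_groupoid_iff]
  intro R
  exact hs.preimage continuous_subtype_val

instance : T2Space X.CoarseGroupoid :=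
  T2Space.of_injective_continuous Subtype.val_injective continuous_val

instance (Z : X.InvSet) : T2Space (Reduction Z) :=
  inferInstanceAs (T2Space {_g : X.CoarseGroupoid // _})

variable {Z : X.InvSet}

lemma InvSet.inv (Z : X.InvSet) {R : ℕ} {ω η : X.StoneCech} (h : (ω, η) ∈ X.entClosure R) :
    η ∈ Z.carrier ↔ ω ∈ Z.carrier := Z.invariant ⟨(ω, η), R, h⟩

/-- The ultrafilters of pairs that are supported on `E_R` and project to `Z × Z`. -/
def band (Z : X.InvSet) (R : ℕ) : Set (Ultrafilter (X.Pt × X.Pt)) :=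
  {U | X.entourage R ∈ U ∧ U.map Prod.fst ∈ Z.carrier ∧ U.map Prod.snd ∈ Z.carrier}

lemma mem_band {R : ℕ} {U : Ultrafilter (X.Pt × X.Pt)} : U ∈ band Z R ↔
    X.entourage R ∈ U ∧ U.map Prod.fst ∈ Z.carrier ∧ U.map Prod.snd ∈ Z.carrier := Iff.rfl

lemma isClosed_band (R : ℕ) : IsClosed (band Z R) :=
  (ultrafilter_isClosed_basic _).inter
    ((Z.isClosed.preimage (continuous_umap _)).inter (Z.isClosed.preimage (continuous_umap _)))

lemma proj_mem {R : ℕ} {U : Ultrafilter (X.Pt × X.Pt)} (hU : X.entourage R ∈ U) :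
    (U.map Prod.fst, U.map Prod.snd) ∈ X.entClosure R := mem_entClosure.2 ⟨U, hU, rfl⟩

/-- The arrow given by an ultrafilter of pairs. -/
def bandArrow (R : ℕ) (U : band Z R) : Reduction Z :=
  ⟨X.entIncl R ⟨proj U.1, mem_entClosure.2 ⟨U.1, U.2.1, rfl⟩⟩, U.2.2⟩

lemma continuous_bandArrow (R : ℕ) : Continuous (bandArrow (Z := Z) R) := by
  refine Continuous.subtype_mk ((continuous_entIncl R).comp ?_) _
  exact Continuous.subtype_mk (continuous_proj.comp continuous_subtype_val) _

/-- The functions on `βX × βX` that are extensions by zero of elements of `C_c(G(X)|_Z)`. -/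
structure IsCc (Z : X.InvSet) (F : X.StoneCech → X.StoneCech → ℂ) : Prop where
  supp : ∃ R, ∀ ω η, F ω η ≠ 0 → ω ∈ Z.carrier ∧ η ∈ Z.carrier ∧ (ω, η) ∈ X.entClosure R
  cont : ∀ R, ContinuousOn (fun U => F (U.map Prod.fst) (U.map Prod.snd)) (band Z R)

lemma isOpen_entClosure (R : ℕ) : IsOpen {g : X.CoarseGroupoid | g.1 ∈ X.entClosure R} := by
  rw [← isClosed_compl_iff, isClosed_groupoid_iff]
  intro S
  have hcl : IsClosed (proj '' {U : Ultrafilter (X.Pt × X.Pt) |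
      X.entourage S ∈ U ∧ (X.entourage R)ᶜ ∈ U}) :=
    (((ultrafilter_isClosed_basic _).inter (ultrafilter_isClosed_basic _)).isCompact.image
      continuous_proj).isClosed
  convert hcl.preimage (continuous_subtype_val (p := fun g => g ∈ X.entClosure S)) using 1
  ext ⟨g, hg⟩
  simp only [Set.mem_preimage, Set.mem_compl_iff, Set.mem_ofPred_eq, Set.mem_image]
  constructor
  · intro h
    obtain ⟨U, hU, rfl⟩ := mem_entClosure.1 hg
    refine ⟨U, ⟨hU, ?_⟩, rfl⟩
    rw [Ultrafilter.compl_mem_iff_notMem]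
    exact fun h' => h (mem_entClosure.2 ⟨U, h', rfl⟩)
  · rintro ⟨U, ⟨hU, hU'⟩, rfl⟩ h
    obtain ⟨W, hW, hp⟩ := mem_entClosure.1 h
    have : W = U := proj_injOn (R := R + S)
      (mem_of_superset hW (entourage_mono (Nat.le_add_right _ _)))
      (mem_of_superset hU (entourage_mono (Nat.le_add_left _ _))) hp
    subst this
    exact (Ultrafilter.compl_mem_iff_notMem.1 hU') hW

lemma exists_of_isCompact {K : Set (Reduction Z)} (hK : IsCompact K) :
    ∃ R, ∀ g ∈ K, g.1.1 ∈ X.entClosure R := by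
  obtain ⟨R, hR⟩ := hK.elim_directed_cover
    (fun R => {g : Reduction Z | g.1.1 ∈ X.entClosure R})
    (fun R => (isOpen_entClosure R).preimage continuous_subtype_val)
    (fun g _ => by
      obtain ⟨R, hR⟩ := g.1.2
      exact Set.mem_iUnion.2 ⟨R, hR⟩)
    (directed_of_isDirected_le fun R S h g hg => entClosure_mono h hg)
  exact ⟨R, fun g hg => hR hg⟩

lemma ConvAlg.ext_of_mem (f : ConvAlg Z) (g : Reduction Z) :
    f.ext g.1.1.1 g.1.1.2 = f.fn g := by
  rw [ConvAlg.ext, dif_pos ⟨g.1.2, g.2⟩]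
  rfl

lemma ConvAlg.continuous_fn (f : ConvAlg Z) : Continuous f.fn :=
  (CompactlySupportedContinuousMap.toContinuousMap f).continuous

lemma ConvAlg.isCc (f : ConvAlg Z) : IsCc Z f.ext := by
  constructor
  · have hc : HasCompactSupport f.fn := CompactlySupportedContinuousMap.hasCompactSupport' f
    obtain ⟨R, hR⟩ := exists_of_isCompact hc.isCompact
    refine ⟨R, fun ω η h => ?_⟩
    rw [ConvAlg.ext] at h
    split_ifs at h with h'
    · exact ⟨h'.2.1, h'.2.2, hR ⟨⟨(ω, η), h'.1⟩, h'.2⟩ (subset_tsupport _ h)⟩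
    · exact absurd rfl h
  · intro R
    rw [continuousOn_iff_continuous_domRestrict]
    convert f.continuous_fn.comp (continuous_bandArrow R) using 1
    ext U
    exact f.ext_of_mem (bandArrow R U)

/-- The element of `C_c(G(X)|_Z)` with a given extension by zero. -/
noncomputable def ConvAlg.mk (F : X.StoneCech → X.StoneCech → ℂ) (hF : IsCc Z F) : ConvAlg Z where
  toFun g := F g.1.1.1 g.1.1.2
  continuous_toFun := by
    rw [continuous_iff_isClosed]
    intro s hs
    have : IsClosed {g : X.CoarseGroupoid | (g.range ∈ Z.carrier ∧ g.source ∈ Z.carrier) ∧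
        F g.1.1 g.1.2 ∈ s} := by
      rw [isClosed_groupoid_iff]
      intro R
      have hcl := (((hF.cont R).preimage_isClosed_of_isClosed (isClosed_band R) hs).isCompact.image
        continuous_proj).isClosed
      convert hcl.preimage (continuous_subtype_val (p := fun g => g ∈ X.entClosure R)) using 1
      ext ⟨g, hg⟩
      constructor
      · rintro ⟨h1, h2⟩
        obtain ⟨U, hU, rfl⟩ := mem_entClosure.1 hg
        exact ⟨U, ⟨⟨hU, h1⟩, h2⟩, rfl⟩
      · rintro ⟨U, ⟨⟨hU, h1⟩, h2⟩, h3⟩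
        obtain rfl : proj U = g := h3
        exact ⟨h1, h2⟩
    have hpre := this.preimage
      (continuous_subtype_val (p := fun g : X.CoarseGroupoid =>
        g.range ∈ Z.carrier ∧ g.source ∈ Z.carrier))
    have heq : (fun g : Reduction Z => F g.1.1.1 g.1.1.2) ⁻¹' s = Subtype.val ⁻¹'
        {g : X.CoarseGroupoid | (g.range ∈ Z.carrier ∧ g.source ∈ Z.carrier) ∧
          F g.1.1 g.1.2 ∈ s} := by
      ext g
      exact ⟨fun h => ⟨g.2, h⟩, fun h => h.2⟩
    exact heq ▸ hpre
  hasCompactSupport' := by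
    obtain ⟨R, hR⟩ := hF.supp
    have : CompactSpace (band Z R) := isCompact_iff_compactSpace.1 (isClosed_band R).isCompact
    refine HasCompactSupport.intro (isCompact_range (continuous_bandArrow (Z := Z) R)) ?_
    intro g hg
    by_contra h
    obtain ⟨h1, h2, h3⟩ := hR _ _ h
    obtain ⟨U, hU, hp⟩ := mem_entClosure.1 h3
    obtain ⟨hp1, hp2⟩ := Prod.mk.inj hp
    refine hg ⟨⟨U, hU, hp1 ▸ h1, hp2 ▸ h2⟩, ?_⟩
    exact Subtype.ext (Subtype.ext hp)

lemma ConvAlg.ext_mk (F : X.StoneCech → X.StoneCech → ℂ) (hF : IsCc Z F) :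
    (ConvAlg.mk F hF).ext = F := by
  funext ω η
  rw [ConvAlg.ext]
  split_ifs with h
  · rfl
  · by_contra hne
    obtain ⟨R, hR⟩ := hF.supp
    obtain ⟨h1, h2, h3⟩ := hR ω η (Ne.symm hne)
    exact h ⟨⟨R, h3⟩, h1, h2⟩

lemma ConvAlg.ext_injective : Function.Injective (ConvAlg.ext (Z := Z)) := by
  intro f g h
  refine CompactlySupportedContinuousMap.ext fun x => ?_
  have := congr_fun₂ h x.1.1.1 x.1.1.2
  rwa [ext_of_mem, ext_of_mem] at this

lemma ConvAlg.ext_zero : (0 : ConvAlg Z).ext = 0 := by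
  funext ω η
  rw [ConvAlg.ext]
  split_ifs <;> rfl

lemma ConvAlg.ext_add (f g : ConvAlg Z) : (f + g).ext = f.ext + g.ext := by
  funext ω η
  simp only [ConvAlg.ext, Pi.add_apply]
  split_ifs
  · rfl
  · simp

lemma ConvAlg.ext_smul (c : ℂ) (f : ConvAlg Z) : (c • f).ext = c • f.ext := by
  funext ω η
  simp only [ConvAlg.ext, Pi.smul_apply]
  split_ifs
  · rfl
  · simp

/-! ### The convolution algebra -/

/-- Convolution: an arrow `(ω, η)` factors as `(ω, ζ)(ζ, η)`. -/
noncomputable def conv (F F' : X.StoneCech → X.StoneCech → ℂ) (ω η : X.StoneCech) : ℂ :=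
  ∑ᶠ ζ, F ω ζ * F' ζ η

/-- The involution. -/
noncomputable def invol (F : X.StoneCech → X.StoneCech → ℂ) (ω η : X.StoneCech) : ℂ :=
  star (F η ω)

open Classical in
/-- A function on the base space, as a function on arrows that vanishes off the units. -/
noncomputable def diag (Z : X.InvSet) (h : X.StoneCech → ℂ) (ω η : X.StoneCech) : ℂ :=
  if ω = η ∧ ω ∈ Z.carrier then h ω else 0

lemma Sections.map_col {R : ℕ} (σ : Sections X R) {ω : X.StoneCech} {b : Fin σ.k}
    (h : {x | σ.col (σ.t b x) = b} ∈ ω) : σ.col ⁻¹' {b} ∈ ω.map (σ.t b) := h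

lemma Sections.dom_mem {R : ℕ} (σ : Sections X R) {ω η : X.StoneCech}
    (h : (ω, η) ∈ X.entClosure R) {b : Fin σ.k} (hb : σ.col ⁻¹' {b} ∈ η) :
    {x | σ.col (σ.t b x) = b} ∈ ω := by
  rw [σ.eq_of_mem h hb] at hb
  exact hb

open Classical in
lemma Sections.finsum_eq {R : ℕ} (σ : Sections X R) (ω : X.StoneCech) (H : X.StoneCech → ℂ)
    (hH : ∀ ζ, H ζ ≠ 0 → (ω, ζ) ∈ X.entClosure R) :
    ∑ᶠ ζ, H ζ = ∑ b, if {x | σ.col (σ.t b x) = b} ∈ ω then H (ω.map (σ.t b)) else 0 := by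
  rw [← Finset.sum_filter]
  rw [finsum_eq_sum_of_support_subset (s := (Finset.univ.filter
    fun b => {x | σ.col (σ.t b x) = b} ∈ ω).image fun b => ω.map (σ.t b))]
  · rw [Finset.sum_image]
    intro b hb c hc hbc
    simp only [Finset.coe_filter, Finset.mem_univ, true_and, Set.mem_ofPred_eq] at hb hc
    have h1 := σ.map_col hb
    have h2 := σ.map_col hc
    dsimp only at hbc
    rw [← hbc] at h2
    exact σ.col_unique h1 h2
  · intro ζ hζ
    obtain ⟨b, hb⟩ := σ.exists_col ζ
    have hmem := hH ζ hζ
    simp only [Finset.coe_image, Finset.coe_filter, Finset.mem_univ, true_and, Set.mem_image,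
      Set.mem_ofPred_eq]
    exact ⟨b, σ.dom_mem hmem hb, (σ.eq_of_mem hmem hb).symm⟩

lemma finite_row {R : ℕ} (ω : X.StoneCech) : {ζ | (ω, ζ) ∈ X.entClosure R}.Finite := by
  obtain ⟨σ⟩ := exists_sections X R
  refine (Set.finite_range fun b => ω.map (σ.t b)).subset fun ζ hζ => ?_
  obtain ⟨b, hb⟩ := σ.exists_col ζ
  exact ⟨b, (σ.eq_of_mem hζ hb).symm⟩

lemma IsCc.finite_row {F : X.StoneCech → X.StoneCech → ℂ} (hF : IsCc Z F) (ω : X.StoneCech) :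
    (Function.support (F ω)).Finite := by
  obtain ⟨R, hR⟩ := hF.supp
  exact (BoxSpace.finite_row ω).subset fun ζ hζ => (hR ω ζ hζ).2.2

lemma continuous_mem_ite {α : Type*} (s : Set α) [∀ U : Ultrafilter α, Decidable (s ∈ U)]
    {B : Set (Ultrafilter α)} {f : Ultrafilter α → ℂ} (hf : ContinuousOn f B) :
    ContinuousOn (fun U => if s ∈ U then f U else 0) B := by
  refine ContinuousOn.if' ?_ ?_ (hf.mono Set.inter_subset_left) continuousOn_const
  · rintro U ⟨-, hU⟩
    have hcl : IsClopen {U : Ultrafilter α | s ∈ U} :=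
      ⟨ultrafilter_isClosed_basic s, ultrafilter_isOpen_basic s⟩
    rw [hcl.frontier_eq] at hU
    exact hU.elim
  · rintro U ⟨-, hU⟩
    have hcl : IsClopen {U : Ultrafilter α | s ∈ U} :=
      ⟨ultrafilter_isClosed_basic s, ultrafilter_isOpen_basic s⟩
    rw [hcl.frontier_eq] at hU
    exact hU.elim

lemma IsCc.conv {F F' : X.StoneCech → X.StoneCech → ℂ} (hF : IsCc Z F) (hF' : IsCc Z F') :
    IsCc Z (conv F F') := by
  classical
  obtain ⟨R, hR⟩ := hF.supp
  obtain ⟨S, hS⟩ := hF'.supp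
  constructor
  · refine ⟨R + S, fun ω η h => ?_⟩
    obtain ⟨ζ, hζ⟩ : ∃ ζ, F ω ζ * F' ζ η ≠ 0 := by
      by_contra hcon
      push Not at hcon
      exact h (finsum_eq_zero_of_forall_eq_zero hcon)
    obtain ⟨h1, h2, h3⟩ := hR _ _ (left_ne_zero_of_mul hζ)
    obtain ⟨h4, h5, h6⟩ := hS _ _ (right_ne_zero_of_mul hζ)
    exact ⟨h1, h5, entClosure_trans h3 h6⟩
  · intro T
    obtain ⟨σ⟩ := exists_sections X R
    have hsum : ∀ U : Ultrafilter (X.Pt × X.Pt),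
        BoxSpace.conv F F' (U.map Prod.fst) (U.map Prod.snd) =
        ∑ b, if {p : X.Pt × X.Pt | σ.col (σ.t b p.1) = b} ∈ U then
          F ((U.map fun p => (p.1, σ.t b p.1)).map Prod.fst)
            ((U.map fun p => (p.1, σ.t b p.1)).map Prod.snd) *
          F' ((U.map fun p => (σ.t b p.1, p.2)).map Prod.fst)
            ((U.map fun p => (σ.t b p.1, p.2)).map Prod.snd) else 0 := by
      intro U
      rw [BoxSpace.conv, σ.finsum_eq _ _ fun ζ hζ => (hR _ _ (left_ne_zero_of_mul hζ)).2.2]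
      simp only [Ultrafilter.map_map]
      rfl
    simp only [hsum]
    refine continuousOn_finsetSum _ fun b _ => continuous_mem_ite _ (ContinuousOn.mul ?_ ?_)
    · refine (hF.cont R).comp (continuous_umap _).continuousOn fun U hU => ?_
      have hz : U.map Prod.fst ∈ Z.carrier := hU.2.1
      refine ⟨entourage_mem_map fun p => σ.near b _, ?_, ?_⟩
      · rw [Ultrafilter.map_map]
        exact hz
      · rw [Ultrafilter.map_map]
        have := (Z.inv (σ.mem (U.map Prod.fst) b)).2 hz
        rwa [Ultrafilter.map_map] at this
    · refine (hF'.cont (R + T)).comp (continuous_umap _).continuousOn fun U hU => ?_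
      have hz : U.map Prod.fst ∈ Z.carrier := hU.2.1
      refine ⟨?_, ?_, ?_⟩
      · rw [Ultrafilter.mem_map]
        filter_upwards [hU.1] with p hp
        refine dist_add ?_ hp
        rw [dist_comm]
        exact σ.near b _
      · rw [Ultrafilter.map_map]
        have := (Z.inv (σ.mem (U.map Prod.fst) b)).2 hz
        rwa [Ultrafilter.map_map] at this
      · rw [Ultrafilter.map_map]
        exact hU.2.2

lemma IsCc.invol {F : X.StoneCech → X.StoneCech → ℂ} (hF : IsCc Z F) : IsCc Z (invol F) := by
  constructor
  · obtain ⟨R, hR⟩ := hF.supp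
    refine ⟨R, fun ω η h => ?_⟩
    obtain ⟨h1, h2, h3⟩ := hR η ω (star_ne_zero.1 h)
    exact ⟨h2, h1, entClosure_symm h3⟩
  · intro R
    have : ContinuousOn (fun U : Ultrafilter (X.Pt × X.Pt) =>
        star (F ((U.map Prod.swap).map Prod.fst) ((U.map Prod.swap).map Prod.snd)))
        (band Z R) := by
      refine continuous_star.comp_continuousOn
        ((hF.cont R).comp (continuous_umap _).continuousOn fun U hU => ⟨?_, ?_, ?_⟩)
      · rw [Ultrafilter.mem_map]
        filter_upwards [hU.1] with p hp
        rw [Set.mem_preimage, mem_entourage, Prod.fst_swap, Prod.snd_swap, dist_comm]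
        exact hp
      · rw [Ultrafilter.map_map]
        exact hU.2.2
      · rw [Ultrafilter.map_map]
        exact hU.2.1
    refine this.congr fun U _ => ?_
    simp only [Ultrafilter.map_map]
    rfl

lemma isCc_diag {h : X.StoneCech → ℂ} (hh : ContinuousOn h Z.carrier) : IsCc Z (diag Z h) := by
  classical
  constructor
  · refine ⟨0, fun ω η hne => ?_⟩
    rw [diag] at hne
    split_ifs at hne with hc
    · obtain ⟨rfl, hz⟩ := hc
      exact ⟨hz, hz, entClosure_refl 0 ω⟩
    · exact absurd rfl hne
  · intro R
    have : ContinuousOn (fun U : Ultrafilter (X.Pt × X.Pt) =>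
        if {p : X.Pt × X.Pt | p.1 = p.2} ∈ U then h (U.map Prod.fst) else 0) (band Z R) :=
      continuous_mem_ite _ (hh.comp (continuous_umap _).continuousOn fun U hU => hU.2.1)
    refine this.congr fun U hU => ?_
    have hiff : {p : X.Pt × X.Pt | p.1 = p.2} ∈ U ↔ U.map Prod.fst = U.map Prod.snd := by
      constructor
      · intro hd
        apply Ultrafilter.coe_injective
        rw [Ultrafilter.coe_map, Ultrafilter.coe_map]
        apply Filter.map_congr
        filter_upwards [hd] with p hp using hp
      · intro heq
        have : U = (U.map Prod.fst).map fun x => (x, x) := by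
          refine proj_injOn hU.1 (entourage_mem_map fun x => ?_) ?_
          · rw [dist_self]
            exact zero_le
          · simp only [proj]
            rw [← heq]
            simp only [Ultrafilter.map_map]
            rfl
        rw [this]
        exact Ultrafilter.mem_map.2 (Filter.univ_mem' fun x => rfl)
    simp only [diag, hiff]
    by_cases hc : U.map Prod.fst = U.map Prod.snd
    · rw [if_pos ⟨hc, hU.2.1⟩, if_pos hc]
    · rw [if_neg hc, if_neg fun h => hc h.1]

lemma conv_assoc {F G K : X.StoneCech → X.StoneCech → ℂ} (hF : IsCc Z F) (hG : IsCc Z G) :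
    conv (conv F G) K = conv F (conv G K) := by
  classical
  funext ω η
  let S := (hF.finite_row ω).toFinset
  let T := S.biUnion fun ξ => (hG.finite_row ξ).toFinset
  have hS : ∀ ξ, F ω ξ ≠ 0 → ξ ∈ S := fun ξ h => (hF.finite_row ω).mem_toFinset.2 h
  have hT : ∀ ξ ζ, F ω ξ ≠ 0 → G ξ ζ ≠ 0 → ζ ∈ T := fun ξ ζ h h' =>
    Finset.mem_biUnion.2 ⟨ξ, hS ξ h, (hG.finite_row ξ).mem_toFinset.2 h'⟩
  have h1 : ∀ ζ, conv F G ω ζ = ∑ ξ ∈ S, F ω ξ * G ξ ζ := fun ζ =>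
    finsum_eq_sum_of_support_subset _ fun ξ h => hS ξ (left_ne_zero_of_mul h)
  have h2 : conv (conv F G) K ω η = ∑ ζ ∈ T, conv F G ω ζ * K ζ η := by
    refine finsum_eq_sum_of_support_subset _ fun ζ h => ?_
    have h' := left_ne_zero_of_mul h
    rw [h1] at h'
    obtain ⟨ξ, -, hξ⟩ := Finset.exists_ne_zero_of_sum_ne_zero h'
    exact hT ξ ζ (left_ne_zero_of_mul hξ) (right_ne_zero_of_mul hξ)
  have h3 : ∀ ξ ∈ S, conv G K ξ η = ∑ ζ ∈ T, G ξ ζ * K ζ η := by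
    intro ξ hξ
    refine finsum_eq_sum_of_support_subset _ fun ζ h => ?_
    exact hT ξ ζ ((hF.finite_row ω).mem_toFinset.1 hξ) (left_ne_zero_of_mul h)
  have h4 : conv F (conv G K) ω η = ∑ ξ ∈ S, F ω ξ * conv G K ξ η :=
    finsum_eq_sum_of_support_subset _ fun ξ h => hS ξ (left_ne_zero_of_mul h)
  have h5 : ∑ ξ ∈ S, F ω ξ * conv G K ξ η = ∑ ξ ∈ S, F ω ξ * ∑ ζ ∈ T, G ξ ζ * K ζ η :=
    Finset.sum_congr rfl fun ξ hξ => by rw [h3 ξ hξ]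
  rw [h2, h4, h5]
  simp only [h1, Finset.sum_mul, Finset.mul_sum]
  rw [Finset.sum_comm]
  simp only [mul_assoc]

lemma diag_conv {F : X.StoneCech → X.StoneCech → ℂ} (hF : IsCc Z F) (h : X.StoneCech → ℂ) :
    conv (diag Z h) F = fun ω η => h ω * F ω η := by
  funext ω η
  rw [conv, finsum_eq_single _ ω]
  · obtain ⟨R, hR⟩ := hF.supp
    by_cases hz : ω ∈ Z.carrier
    · rw [diag, if_pos ⟨rfl, hz⟩]
    · have : F ω η = 0 := by
        by_contra hne
        exact hz (hR _ _ hne).1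
      rw [this, mul_zero, mul_zero]
  · intro ζ hζ
    rw [diag, if_neg fun h => hζ h.1.symm, zero_mul]

lemma conv_diag {F : X.StoneCech → X.StoneCech → ℂ} (hF : IsCc Z F) (h : X.StoneCech → ℂ) :
    conv F (diag Z h) = fun ω η => F ω η * h η := by
  funext ω η
  rw [conv, finsum_eq_single _ η]
  · obtain ⟨R, hR⟩ := hF.supp
    by_cases hz : η ∈ Z.carrier
    · rw [diag, if_pos ⟨rfl, hz⟩]
    · have : F ω η = 0 := by
        by_contra hne
        exact hz (hR _ _ hne).2.1
      rw [this, zero_mul, zero_mul]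
  · intro ζ hζ
    rw [diag, if_neg fun h => hζ h.1, mul_zero]

namespace ConvAlg

/-- The convolution product: `(f * g)(ω, η)` is the sum of `f(ω, ζ) g(ζ, η)` over `ζ`. -/
noncomputable instance : Mul (ConvAlg Z) :=
  ⟨fun f g => mk (conv f.ext g.ext) (f.isCc.conv g.isCc)⟩

/-- The unit: the indicator function of the space of units. -/
noncomputable instance : One (ConvAlg Z) :=
  ⟨mk (diag Z fun _ => 1) (isCc_diag continuousOn_const)⟩

/-- The involution: `f*(ω, η)` is the conjugate of `f(η, ω)`. -/
noncomputable instance : Star (ConvAlg Z) := ⟨fun f => mk (invol f.ext) f.isCc.invol⟩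

lemma ext_mul (f g : ConvAlg Z) : (f * g).ext = conv f.ext g.ext := ext_mk _ _

lemma ext_one : (1 : ConvAlg Z).ext = diag Z fun _ => 1 := ext_mk _ _

lemma ext_star (f : ConvAlg Z) : (star f).ext = invol f.ext := ext_mk _ _

lemma add_mul_aux (f g h : ConvAlg Z) : (f + g) * h = f * h + g * h := by
  apply ext_injective
  rw [ext_mul, ext_add, ext_add, ext_mul, ext_mul]
  funext ω η
  simp only [conv, Pi.add_apply, add_mul]
  exact finsum_add_distrib
    ((f.isCc.finite_row ω).subset fun ζ hζ => left_ne_zero_of_mul hζ)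
    ((g.isCc.finite_row ω).subset fun ζ hζ => left_ne_zero_of_mul hζ)

lemma mul_add_aux (f g h : ConvAlg Z) : f * (g + h) = f * g + f * h := by
  apply ext_injective
  rw [ext_mul, ext_add, ext_add, ext_mul, ext_mul]
  funext ω η
  simp only [conv, Pi.add_apply, mul_add]
  exact finsum_add_distrib
    ((f.isCc.finite_row ω).subset fun ζ hζ => left_ne_zero_of_mul hζ)
    ((f.isCc.finite_row ω).subset fun ζ hζ => left_ne_zero_of_mul hζ)

lemma zero_mul_aux (f : ConvAlg Z) : 0 * f = 0 := by
  apply ext_injective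
  rw [ext_mul, ext_zero]
  funext ω η
  simp [conv]

lemma mul_zero_aux (f : ConvAlg Z) : f * 0 = 0 := by
  apply ext_injective
  rw [ext_mul, ext_zero]
  funext ω η
  simp [conv]

lemma mul_assoc_aux (f g h : ConvAlg Z) : f * g * h = f * (g * h) := by
  apply ext_injective
  rw [ext_mul, ext_mul, ext_mul, ext_mul, conv_assoc f.isCc g.isCc]

lemma one_mul_aux (f : ConvAlg Z) : 1 * f = f := by
  apply ext_injective
  rw [ext_mul, ext_one, diag_conv f.isCc]
  simp

lemma mul_one_aux (f : ConvAlg Z) : f * 1 = f := by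
  apply ext_injective
  rw [ext_mul, ext_one, conv_diag f.isCc]
  simp

noncomputable instance : Ring (ConvAlg Z) where
  __ := (inferInstance : AddCommGroup (ConvAlg Z))
  left_distrib := mul_add_aux
  right_distrib := add_mul_aux
  zero_mul := zero_mul_aux
  mul_zero := mul_zero_aux
  mul_assoc := mul_assoc_aux
  one_mul := one_mul_aux
  mul_one := mul_one_aux

noncomputable instance : Algebra ℂ (ConvAlg Z) :=
  Algebra.ofModule
    (fun c f g => by
      apply ext_injective
      rw [ext_mul, ext_smul, ext_smul, ext_mul]
      funext ω η
      simp only [conv, Pi.smul_apply, smul_eq_mul, mul_assoc, mul_finsum])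
    (fun c f g => by
      apply ext_injective
      rw [ext_mul, ext_smul, ext_smul, ext_mul]
      funext ω η
      simp only [conv, Pi.smul_apply, smul_eq_mul, mul_left_comm _ c, mul_finsum])

noncomputable instance : StarRing (ConvAlg Z) where
  star_involutive f := by
    apply ext_injective
    rw [ext_star, ext_star]
    funext ω η
    simp [invol]
  star_mul f g := by
    apply ext_injective
    rw [ext_star, ext_mul, ext_mul, ext_star, ext_star]
    funext ω η
    have hfin : (Function.support fun ζ => f.ext η ζ * g.ext ζ ω).Finite :=
      (f.isCc.finite_row η).subset fun ζ hζ => left_ne_zero_of_mul hζ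
    simp only [invol, conv]
    rw [← starAddEquiv_apply, AddEquiv.map_finsum starAddEquiv]
    simp [mul_comm]
  star_add f g := by
    apply ext_injective
    rw [ext_star, ext_add, ext_add, ext_star, ext_star]
    funext ω η
    simp [invol]

instance : StarModule ℂ (ConvAlg Z) where
  star_smul c f := by
    apply ext_injective
    rw [ext_star, ext_smul, ext_smul, ext_star]
    funext ω η
    simp [invol]

end ConvAlg

/-! ### The maximal C*-algebra -/

/-- A representation of the unital *-algebra `C_c(G(X)|_Z)`: a unital *-homomorphism to the
bounded operators on a nonzero Hilbert space. -/
structure Rep (Z : X.InvSet) : Type (u + 1) where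
  /-- The Hilbert space. -/
  H : Type u
  [normed : NormedAddCommGroup H]
  [inner : InnerProductSpace ℂ H]
  [complete : CompleteSpace H]
  [nontrivial : Nontrivial H]
  /-- The homomorphism. -/
  π : ConvAlg Z →⋆ₐ[ℂ] (H →L[ℂ] H)

attribute [instance] Rep.normed Rep.inner Rep.complete Rep.nontrivial

lemma norm_le_of_star_mul_add {H : Type*} [NormedAddCommGroup H] [InnerProductSpace ℂ H]
    [CompleteSpace H] {M : ℝ} (hM : 0 ≤ M) (a k : H →L[ℂ] H)
    (h : star a * a + star k * k = ((M ^ 2 : ℝ) : ℂ) • 1) : ‖a‖ ≤ M := by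
  refine ContinuousLinearMap.opNorm_le_bound _ hM fun v => ?_
  have h1 : ∀ b : H →L[ℂ] H, inner ℂ ((star b * b) v) v = ((‖b v‖ ^ 2 : ℝ) : ℂ) := by
    intro b
    rw [ContinuousLinearMap.star_eq_adjoint, mul_apply_eq_comp,
      ContinuousLinearMap.adjoint_inner_left, inner_self_eq_norm_sq_to_K]
    push_cast
    rfl
  have h2 := congrArg (fun T : H →L[ℂ] H => inner ℂ (T v) v) h
  simp only [add_apply, inner_add_left, h1, smul_apply,
    one_apply_eq_self, inner_smul_left, inner_self_eq_norm_sq_to_K,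
    Complex.conj_ofReal] at h2
  have h3 : ‖a v‖ ^ 2 + ‖k v‖ ^ 2 = M ^ 2 * ‖v‖ ^ 2 := by
    have h4 : ((‖a v‖ ^ 2 + ‖k v‖ ^ 2 : ℝ) : ℂ) = ((M ^ 2 * ‖v‖ ^ 2 : ℝ) : ℂ) := by
      push_cast at h2 ⊢
      exact h2
    exact_mod_cast h4
  refine le_of_sq_le_sq ?_ (by positivity)
  nlinarith [sq_nonneg ‖k v‖]

lemma IsCc.continuousOn_diag {F : X.StoneCech → X.StoneCech → ℂ} (hF : IsCc Z F) :
    ContinuousOn (fun ω => F ω ω) Z.carrier := by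
  have : ContinuousOn (fun ω : X.StoneCech => F ((ω.map fun x => (x, x)).map Prod.fst)
      ((ω.map fun x => (x, x)).map Prod.snd)) Z.carrier := by
    refine (hF.cont 0).comp (continuous_umap _).continuousOn fun ω hω => ⟨?_, ?_, ?_⟩
    · refine entourage_mem_map fun x => ?_
      rw [dist_self]
      exact zero_le
    · rw [Ultrafilter.map_map]
      exact (ω.map_id).symm ▸ hω
    · rw [Ultrafilter.map_map]
      exact (ω.map_id).symm ▸ hω
  refine this.congr fun ω _ => ?_
  simp only [Ultrafilter.map_map]
  exact congrArg₂ F ω.map_id.symm ω.map_id.symm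

lemma exists_bound (f : ConvAlg Z) : ∃ M : ℝ, 0 ≤ M ∧ ∀ ω η, ‖f.ext ω η‖ ≤ M := by
  obtain ⟨M, hM⟩ := f.continuous_fn.bounded_above_of_compact_support
    (CompactlySupportedContinuousMap.hasCompactSupport' f)
  refine ⟨max M 0, le_max_right _ _, fun ω η => ?_⟩
  rw [ConvAlg.ext]
  split_ifs
  · exact (hM _).trans (le_max_left _ _)
  · simp

/-- An element supported on a bisection is bounded in every representation. -/
lemma exists_complement (g : ConvAlg Z) {M : ℝ} (hM : ∀ ω η, ‖g.ext ω η‖ ≤ M)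
    (hr : ∀ ω η η', g.ext ω η ≠ 0 → g.ext ω η' ≠ 0 → η = η')
    (hs : ∀ ω ω' η, g.ext ω η ≠ 0 → g.ext ω' η ≠ 0 → ω = ω') :
    ∃ k : ConvAlg Z, star g * g + star k * k = ((M ^ 2 : ℝ) : ℂ) • 1 := by
  have hval : ∀ η, ∃ r : ℝ, (star g * g).ext η η = r ∧ r ≤ M ^ 2 := by
    intro η
    rw [ConvAlg.ext_mul, ConvAlg.ext_star]
    by_cases h : ∃ ω, g.ext ω η ≠ 0
    · obtain ⟨ω, hω⟩ := h
      refine ⟨‖g.ext ω η‖ ^ 2, ?_, by gcongr; exact hM _ _⟩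
      rw [conv, finsum_eq_single _ ω]
      · rw [invol, Complex.star_def, Complex.conj_mul']
        push_cast
        rfl
      · intro ω' hne
        by_cases h0 : g.ext ω' η = 0
        · rw [h0, mul_zero]
        · exact absurd (hs _ _ _ h0 hω) hne
    · push Not at h
      refine ⟨0, ?_, sq_nonneg M⟩
      rw [conv, finsum_eq_zero_of_forall_eq_zero]
      · simp
      · intro ω
        rw [h ω, mul_zero]
  choose r hr1 hr2 using hval
  have hre : ∀ η, r η = ((star g * g).ext η η).re := fun η => by rw [hr1]; simp
  have hcont : ContinuousOn (fun η => ((Real.sqrt (M ^ 2 - r η) : ℝ) : ℂ)) Z.carrier := by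
    refine Complex.continuous_ofReal.comp_continuousOn (Real.continuous_sqrt.comp_continuousOn
      (continuousOn_const.sub ?_))
    rw [funext hre]
    exact Complex.continuous_re.comp_continuousOn (star g * g).isCc.continuousOn_diag
  refine ⟨ConvAlg.mk _ (isCc_diag hcont), ?_⟩
  apply ConvAlg.ext_injective
  rw [ConvAlg.ext_add, ConvAlg.ext_smul, ConvAlg.ext_mul (star (ConvAlg.mk _ _)), ConvAlg.ext_one,
    ConvAlg.ext_mk, conv_diag (ConvAlg.isCc _), ConvAlg.ext_star, ConvAlg.ext_mk]
  funext ω η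
  simp only [Pi.add_apply, Pi.smul_apply, smul_eq_mul, invol]
  by_cases hc : ω = η ∧ ω ∈ Z.carrier
  · obtain ⟨rfl, hz⟩ := hc
    rw [diag, diag, if_pos ⟨rfl, hz⟩, if_pos ⟨rfl, hz⟩, hr1, Complex.star_def, Complex.conj_ofReal,
      ← Complex.ofReal_mul, Real.mul_self_sqrt (sub_nonneg.2 (hr2 ω))]
    push_cast
    ring
  · have hc' : ¬ (η = ω ∧ η ∈ Z.carrier) := fun h => hc ⟨h.1.symm, h.1 ▸ h.2⟩
    rw [diag, diag, if_neg hc, if_neg hc']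
    simp only [star_zero, zero_mul, add_zero, mul_zero]
    by_contra hne
    obtain ⟨R, hR⟩ := (star g * g).isCc.supp
    have hz := (hR _ _ hne).1
    rw [ConvAlg.ext_mul, ConvAlg.ext_star] at hne
    obtain ⟨ζ, hζ⟩ : ∃ ζ, invol g.ext ω ζ * g.ext ζ η ≠ 0 := by
      by_contra hcon
      push Not at hcon
      exact hne (finsum_eq_zero_of_forall_eq_zero hcon)
    exact hc ⟨hr ζ ω η (star_ne_zero.1 (left_ne_zero_of_mul hζ)) (right_ne_zero_of_mul hζ), hz⟩

/-- The norms of an element in all representations are uniformly bounded. -/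
lemma exists_rep_bound (f : ConvAlg Z) : ∃ C : ℝ, ∀ ρ : Rep Z, ‖ρ.π f‖ ≤ C := by
  classical
  obtain ⟨M, hM0, hM⟩ := exists_bound f
  obtain ⟨R, hR⟩ := f.isCc.supp
  obtain ⟨σ⟩ := exists_sections X R
  have hcont : ∀ b, ContinuousOn (fun ω : X.StoneCech => if σ.col ⁻¹' {b} ∈ ω then (1 : ℂ) else 0)
      Z.carrier := fun b => continuous_mem_ite _ continuousOn_const
  let e : Fin σ.k → ConvAlg Z := fun b => ConvAlg.mk _ (isCc_diag (hcont b))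
  have he : ∑ b, e b = 1 := by
    have hsum : ∀ s : Finset (Fin σ.k), ∀ ω η,
        (∑ b ∈ s, e b).ext ω η = ∑ b ∈ s, (e b).ext ω η := by
      intro s ω η
      induction s using Finset.induction_on with
      | empty => simp [ConvAlg.ext_zero]
      | insert b s hb ih =>
        rw [Finset.sum_insert hb, Finset.sum_insert hb, ConvAlg.ext_add, Pi.add_apply,
          Pi.add_apply, ih]
    apply ConvAlg.ext_injective
    funext ω η
    rw [hsum, ConvAlg.ext_one]
    simp only [e, ConvAlg.ext_mk, diag]
    by_cases hc : ω = η ∧ ω ∈ Z.carrier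
    · simp only [if_pos hc]
      obtain ⟨b, hb⟩ := σ.exists_col ω
      rw [Finset.sum_eq_single b, if_pos hb]
      · intro c _ hne
        rw [if_neg fun h => hne (σ.col_unique h hb)]
      · intro h
        exact absurd (Finset.mem_univ b) h
    · simp only [if_neg hc, Finset.sum_const_zero]
  have hdec : f = ∑ a, ∑ b, e a * f * e b := by
    simp only [← Finset.mul_sum, he, mul_one]
    rw [← Finset.sum_mul, he, one_mul]
  have hval : ∀ a b ω η, (e a * f * e b).ext ω η =
      (if σ.col ⁻¹' {a} ∈ ω then (1 : ℂ) else 0) * f.ext ω η *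
        (if σ.col ⁻¹' {b} ∈ η then (1 : ℂ) else 0) := by
    intro a b ω η
    rw [ConvAlg.ext_mul, ConvAlg.ext_mk, conv_diag (ConvAlg.isCc _), ConvAlg.ext_mul,
      ConvAlg.ext_mk, diag_conv f.isCc]
  have hne : ∀ a b ω η, (e a * f * e b).ext ω η ≠ 0 →
      σ.col ⁻¹' {a} ∈ ω ∧ σ.col ⁻¹' {b} ∈ η ∧ (ω, η) ∈ X.entClosure R := by
    intro a b ω η h
    rw [hval] at h
    refine ⟨?_, ?_, (hR _ _ (right_ne_zero_of_mul (left_ne_zero_of_mul h))).2.2⟩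
    · by_contra hcon
      simp [hcon] at h
    · by_contra hcon
      simp [hcon] at h
  refine ⟨∑ _a : Fin σ.k, ∑ _b : Fin σ.k, M, fun ρ => ?_⟩
  rw [hdec, map_sum]
  refine norm_sum_le_of_le _ fun a _ => ?_
  rw [map_sum]
  refine norm_sum_le_of_le _ fun b _ => ?_
  obtain ⟨k, hk⟩ := exists_complement (e a * f * e b) (M := M)
    (by
      intro ω η
      rw [hval]
      split_ifs <;> simp [hM, hM0])
    (by
      intro ω η η' h h'
      obtain ⟨-, h1, h2⟩ := hne _ _ _ _ h
      obtain ⟨-, h3, h4⟩ := hne _ _ _ _ h'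
      rw [σ.eq_of_mem h2 h1, σ.eq_of_mem h4 h3])
    (by
      intro ω ω' η h h'
      obtain ⟨h1, -, h2⟩ := hne _ _ _ _ h
      obtain ⟨h3, -, h4⟩ := hne _ _ _ _ h'
      rw [σ.eq_of_mem (entClosure_symm h2) h1, σ.eq_of_mem (entClosure_symm h4) h3])
  refine norm_le_of_star_mul_add hM0 _ (ρ.π k) ?_
  have := congrArg ρ.π hk
  rwa [map_add, map_mul ρ.π (star (e a * f * e b)), map_mul ρ.π (star k), map_star, map_star,
    map_smul, map_one] at this

/-- The universal representation: an element is sent to the bounded family of its images in all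
representations. The norm of this family is the supremum of the norms of the images. -/
noncomputable def universalRep (Z : X.InvSet) :
    ConvAlg Z →⋆ₐ[ℂ] lp (fun ρ : Rep Z => ρ.H →L[ℂ] ρ.H) ∞ where
  toFun f := ⟨fun ρ => ρ.π f, by
    obtain ⟨C, hC⟩ := exists_rep_bound f
    refine memℓp_infty ⟨C, ?_⟩
    rintro _ ⟨ρ, rfl⟩
    exact hC ρ⟩
  map_one' := by
    ext ρ : 2
    exact map_one ρ.π
  map_mul' f g := by
    ext ρ : 2
    exact map_mul ρ.π f g
  map_zero' := by
    ext ρ : 2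
    exact map_zero ρ.π
  map_add' f g := by
    ext ρ : 2
    exact map_add ρ.π f g
  commutes' c := by
    ext ρ : 2
    exact AlgHomClass.commutes ρ.π c
  map_star' f := by
    ext ρ : 2
    exact map_star ρ.π f

/-- The maximal C*-algebra `C*_max(G(X)|_Z)`: the completion of `C_c(G(X)|_Z)` for the supremum of
the norms in all representations, realised as the closure of its image under the universal
representation. -/
noncomputable def maxCstar (Z : X.InvSet) :
    StarSubalgebra ℂ (lp (fun ρ : Rep Z => ρ.H →L[ℂ] ρ.H) ∞) :=
  (universalRep Z).range.topologicalClosure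

/-- The canonical map from `C_c(G(X)|_Z)` to `C*_max(G(X)|_Z)`. -/
noncomputable def toMaxCstar {Z : X.InvSet} (f : ConvAlg Z) : maxCstar Z :=
  ⟨universalRep Z f, StarSubalgebra.le_topologicalClosure _ (Set.mem_range_self f)⟩

/-! ### The core -/

variable (X)

/-- The boundary `∂βA` in `βX` of a set of vertices: its closure without the vertices. -/
def boundary (A : Set X.Pt) : Set X.StoneCech :=
  closure ((pure : X.Pt → X.StoneCech) '' A) \ Set.range (pure : X.Pt → X.StoneCech)

/-- The saturation of a subset of `βX`. -/
def sat (A : Set X.StoneCech) : Set X.StoneCech :=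
  {ω | ∃ g : X.CoarseGroupoid, g.range ∈ A ∧ g.source = ω}

/-- The union of a sequence of sets of vertices. -/
def union (Y : ∀ i, Set (X.V i)) : Set X.Pt := {p | p.2 ∈ Y p.1}

/-- The underlying set of the core of `Y`: the complement in `∂βX` of the saturation of the
boundary of the complement of `Y`. -/
def coreSet (Y : ∀ i, Set (X.V i)) : Set X.StoneCech :=
  X.boundary Set.univ \ X.sat (X.boundary (X.union Y)ᶜ)

variable {X}

lemma mem_closure_pure {A : Set X.Pt} {ω : X.StoneCech} :
    ω ∈ closure ((pure : X.Pt → X.StoneCech) '' A) ↔ A ∈ ω := by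
  constructor
  · intro h
    refine closure_minimal (t := {η : X.StoneCech | A ∈ η}) ?_ (ultrafilter_isClosed_basic A) h
    rintro _ ⟨x, hx, rfl⟩
    exact hx
  · intro h
    refine mem_closure_of_tendsto (Ultrafilter.tendsto_pure_self ω) ?_
    filter_upwards [h] with x hx
    exact ⟨x, hx, rfl⟩

lemma mem_boundary {A : Set X.Pt} {ω : X.StoneCech} :
    ω ∈ X.boundary A ↔ A ∈ ω ∧ ω ∉ Set.range (pure : X.Pt → X.StoneCech) :=
  and_congr_left' mem_closure_pure

lemma mem_sat {A : Set X.StoneCech} {ω : X.StoneCech} :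
    ω ∈ X.sat A ↔ ∃ a ∈ A, ∃ R, (a, ω) ∈ X.entClosure R := by
  constructor
  · rintro ⟨g, hg, rfl⟩
    exact ⟨g.range, hg, g.2⟩
  · rintro ⟨a, ha, h⟩
    exact ⟨⟨(a, ω), h⟩, ha, rfl⟩

lemma principal_of_mem {R : ℕ} {ω η : X.StoneCech} (h : (ω, η) ∈ X.entClosure R)
    (hω : ω ∈ Set.range (pure : X.Pt → X.StoneCech)) :
    η ∈ Set.range (pure : X.Pt → X.StoneCech) := by
  obtain ⟨σ⟩ := exists_sections X R
  obtain ⟨b, hb⟩ := σ.exists_col η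
  obtain ⟨x, rfl⟩ := hω
  rw [σ.eq_of_mem h hb]
  exact ⟨σ.t b x, (Ultrafilter.map_pure _ _).symm⟩

lemma mem_sat_boundary {A : Set X.Pt} {ω : X.StoneCech}
    (hω : ω ∉ Set.range (pure : X.Pt → X.StoneCech)) :
    ω ∈ X.sat (X.boundary A) ↔ ∃ R : ℕ, {x | ∃ y ∈ A, X.dist x y ≤ R} ∈ ω := by
  classical
  rw [mem_sat]
  constructor
  · rintro ⟨a, ha, R, h⟩
    refine ⟨R, ?_⟩
    obtain ⟨σ⟩ := exists_sections X R
    obtain ⟨b, hb⟩ := σ.exists_col ω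
    rw [σ.eq_of_mem h hb, Ultrafilter.mem_map]
    filter_upwards [(mem_boundary.1 ha).1] with x hx
    refine ⟨x, hx, ?_⟩
    rw [dist_comm]
    exact σ.near b x
  · rintro ⟨R, hR⟩
    let t : X.Pt → X.Pt := fun x => if h : ∃ y ∈ A, X.dist x y ≤ R then h.choose else x
    have ht : ∀ x, X.dist (t x) x ≤ R := by
      intro x
      rw [dist_comm]
      by_cases h : ∃ y ∈ A, X.dist x y ≤ R
      · simp only [t, dif_pos h]
        exact h.choose_spec.2
      · simp only [t, dif_neg h, dist_self]
        exact zero_le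
    have hmem : (ω.map t, ω) ∈ X.entClosure R := by
      refine mem_entClosure.2 ⟨ω.map fun x => (t x, x), entourage_mem_map ht, ?_⟩
      exact Prod.ext (by simp only [proj, Ultrafilter.map_map]; rfl)
        (by simp only [proj, Ultrafilter.map_map]; exact ω.map_id)
    refine ⟨ω.map t, mem_boundary.2 ⟨?_, fun h => hω (principal_of_mem hmem h)⟩, R, hmem⟩
    rw [Ultrafilter.mem_map]
    filter_upwards [hR] with x hx
    have : t x = hx.choose := dif_pos hx
    rw [Set.mem_preimage, this]
    exact hx.choose_spec.1

lemma isClosed_coreSet (Y : ∀ i, Set (X.V i)) : IsClosed (X.coreSet Y) := by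
  have heq : X.coreSet Y = (Set.range (pure : X.Pt → X.StoneCech))ᶜ ∩
      ⋂ R : ℕ, {ω : X.StoneCech | {x | ∃ y ∈ (X.union Y)ᶜ, X.dist x y ≤ R} ∈ ω}ᶜ := by
    ext ω
    by_cases hω : ω ∈ Set.range (pure : X.Pt → X.StoneCech)
    · exact iff_of_false (fun h => (mem_boundary.1 h.1).2 hω) (fun h => h.1 hω)
    · have h1 : ω ∈ X.boundary Set.univ := mem_boundary.2 ⟨univ_mem, hω⟩
      rw [coreSet, Set.mem_sdiff, mem_sat_boundary hω]
      simp only [h1, true_and, not_exists, Set.mem_inter_iff, Set.mem_compl_iff, hω,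
        not_false_eq_true, Set.mem_iInter]
      rfl
  rw [heq]
  refine IsClosed.inter (isOpen_compl_iff.1 ?_) (isClosed_iInter fun R => ?_)
  · rw [compl_compl, ← Set.iUnion_singleton_eq_range]
    refine isOpen_iUnion fun x => ?_
    convert ultrafilter_isOpen_basic ({x} : Set X.Pt) using 1
    ext ω
    constructor
    · rintro rfl
      exact Set.mem_singleton x
    · intro h
      obtain ⟨y, hy, rfl⟩ := Ultrafilter.eq_pure_of_finite_mem (Set.finite_singleton x) h
      rw [Set.mem_singleton_iff.1 hy]
      rfl
  · exact (ultrafilter_isOpen_basic _).isClosed_compl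

/-- The core of `Y`, as a closed invariant subset of `βX`. -/
def core (Y : ∀ i, Set (X.V i)) : X.InvSet where
  carrier := X.coreSet Y
  isClosed := isClosed_coreSet Y
  invariant := by
    have key : ∀ {R : ℕ} {ω η : X.StoneCech}, (ω, η) ∈ X.entClosure R → ω ∈ X.coreSet Y →
        η ∈ X.coreSet Y := by
      rintro R ω η h ⟨h1, h2⟩
      refine ⟨mem_boundary.2 ⟨univ_mem, fun h' => (mem_boundary.1 h1).2
        (principal_of_mem (entClosure_symm h) h')⟩, fun h3 => h2 ?_⟩
      obtain ⟨a, ha, S, hS⟩ := mem_sat.1 h3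
      exact mem_sat.2 ⟨a, ha, S + R, entClosure_trans hS (entClosure_symm h)⟩
    rintro ⟨⟨ω, η⟩, R, h⟩
    exact ⟨key (entClosure_symm h), key h⟩

/-! ### The Laplace operator -/

variable (X)

open Classical in
/-- The matrix of the Laplace operator. -/
noncomputable def lapMatrix (x y : X.Pt) : ℂ :=
  if x = y then ((X.total.neighborSet x).ncard : ℂ) else if X.total.Adj x y then -1 else 0

open Classical in
/-- The matrix of the Laplace operator, extended by continuity from `E_1` to the closure of `E_1`
in `βX × βX`, and by zero to the other arrows of the coarse groupoid. (All entries off `E_1`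
vanish.) -/
noncomputable def lapExt (ω η : X.StoneCech) : ℂ :=
  if (ω, η) ∈ X.entClosure 1 then
    limUnder (((ω : Filter X.Pt) ×ˢ (η : Filter X.Pt)) ⊓ 𝓟 (X.entourage 1))
      (fun p => X.lapMatrix p.1 p.2)
  else 0

variable {X}

lemma lapMatrix_eq_zero {x y : X.Pt} (h : (x, y) ∉ X.entourage 1) : X.lapMatrix x y = 0 := by
  rw [mem_entourage] at h
  have h' : ¬ (X.total.Adj x y ∨ x = y) := fun h1 =>
    h (by exact_mod_cast SimpleGraph.edist_le_one_iff_adj_or_eq.2 h1)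
  rw [lapMatrix, if_neg fun h1 => h' (Or.inr h1), if_neg fun h1 => h' (Or.inl h1)]

lemma lapExt_eq {S : ℕ} {U : Ultrafilter (X.Pt × X.Pt)} (hU : X.entourage S ∈ U) {c : ℂ}
    (hc : {p : X.Pt × X.Pt | X.lapMatrix p.1 p.2 = c} ∈ U) :
    X.lapExt (U.map Prod.fst) (U.map Prod.snd) = c := by
  have huniq : ∀ W : Ultrafilter (X.Pt × X.Pt), X.entourage 1 ∈ W → proj W = proj U → W = U :=
    fun W hW hp => proj_injOn (R := 1 + S)
      (mem_of_superset hW (entourage_mono (Nat.le_add_right _ _)))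
      (mem_of_superset hU (entourage_mono (Nat.le_add_left _ _))) hp
  rw [lapExt]
  split_ifs with h
  · obtain ⟨W, hW, hp⟩ := mem_entClosure.1 h
    obtain rfl := huniq W hW hp
    have hle : (((W.map Prod.fst : X.StoneCech) : Filter X.Pt) ×ˢ
        ((W.map Prod.snd : X.StoneCech) : Filter X.Pt)) ⊓ 𝓟 (X.entourage 1) ≤ W := by
      rw [Filter.le_iff_ultrafilter]
      intro W' hW'
      have h1 : X.entourage 1 ∈ W' := le_principal_iff.1 (hW'.trans inf_le_right)
      have h2 := hW'.trans inf_le_left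
      have h3 : W'.map Prod.fst = W.map Prod.fst :=
        Ultrafilter.eq_of_le (tendsto_fst.mono_left h2)
      have h4 : W'.map Prod.snd = W.map Prod.snd :=
        Ultrafilter.eq_of_le (tendsto_snd.mono_left h2)
      rw [huniq W' h1 (Prod.ext h3 h4)]
    have hge : (W : Filter (X.Pt × X.Pt)) ≤ (((W.map Prod.fst : X.StoneCech) : Filter X.Pt) ×ˢ
        ((W.map Prod.snd : X.StoneCech) : Filter X.Pt)) ⊓ 𝓟 (X.entourage 1) := by
      refine le_inf ?_ (le_principal_iff.2 hW)
      rw [Filter.le_prod]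
      exact ⟨tendsto_map, tendsto_map⟩
    have hne := W.neBot.mono hge
    refine Tendsto.limUnder_eq (Tendsto.mono_left ?_ hle)
    refine tendsto_const_nhds.congr' ?_
    filter_upwards [hc] with p hp using (Eq.symm hp)
  · have h1 : (X.entourage 1)ᶜ ∈ U := by
      rw [Ultrafilter.compl_mem_iff_notMem]
      exact fun h' => h (proj_mem h')
    obtain ⟨p, hp, hp'⟩ := U.nonempty_of_mem (inter_mem hc h1)
    exact (lapMatrix_eq_zero hp').symm.trans hp

lemma lapMatrix_eventually (U : Ultrafilter (X.Pt × X.Pt)) :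
    ∃ c, {p : X.Pt × X.Pt | X.lapMatrix p.1 p.2 = c} ∈ U := by
  obtain ⟨d, hd⟩ := exists_degree_bound X
  have hfin : (({-1, 0} : Set ℂ) ∪ (fun n : ℕ => (n : ℂ)) '' Set.Iic d).Finite :=
    (Set.toFinite _).union ((Set.finite_Iic d).image _)
  have : ∀ᶠ p in (U : Filter (X.Pt × X.Pt)),
      ∃ c ∈ ({-1, 0} : Set ℂ) ∪ (fun n : ℕ => (n : ℂ)) '' Set.Iic d,
        X.lapMatrix p.1 p.2 = c := by
    refine Eventually.of_forall fun p => ⟨_, ?_, rfl⟩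
    rw [lapMatrix]
    split_ifs
    · exact Or.inr ⟨_, (hd p.1).2, rfl⟩
    · exact Or.inl (by simp)
    · exact Or.inl (by simp)
  obtain ⟨c, -, hc⟩ := (Ultrafilter.eventually_exists_mem_iff hfin).1 this
  exact ⟨c, hc⟩

open Classical in
lemma isCc_lap (Z : X.InvSet) :
    IsCc Z fun ω η => if ω ∈ Z.carrier ∧ η ∈ Z.carrier then X.lapExt ω η else 0 := by
  constructor
  · refine ⟨1, fun ω η h => ?_⟩
    split_ifs at h with h'
    · rw [lapExt] at h
      split_ifs at h with h1
      · exact ⟨h'.1, h'.2, h1⟩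
      · exact absurd rfl h
    · exact absurd rfl h
  · intro S U hU
    obtain ⟨c, hc⟩ := lapMatrix_eventually U
    refine ContinuousWithinAt.congr_of_eventuallyEq_of_mem (f := fun _ => c)
      continuousWithinAt_const ?_ hU
    filter_upwards [self_mem_nhdsWithin, mem_nhdsWithin_of_mem_nhds
      ((ultrafilter_isOpen_basic _).mem_nhds hc)] with W hW hW'
    rw [if_pos hW.2]
    exact lapExt_eq hW.1 hW'

open Classical in
/-- The Laplace operator as an element of `C_c(G(X)|_Z)`. -/
noncomputable def laplacian (Z : X.InvSet) : ConvAlg Z := ConvAlg.mk _ (isCc_lap Z)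

/-! ### Almost boundary property (T) and approximate isomorphism -/

/-- An element of a complex algebra has spectral gap if its spectrum is contained in
`{0} ∪ [c, ∞)` for some `c > 0`. -/
def HasSpectralGap {A : Type*} [Ring A] [Algebra ℂ A] (a : A) : Prop :=
  ∃ c : ℝ, 0 < c ∧ spectrum ℂ a ⊆ {0} ∪ (fun r : ℝ => (r : ℂ)) '' Set.Ici c

variable (X)

/-- Almost boundary geometric property (T). -/
def AlmostBoundaryT : Prop :=
  ∃ Y : ∀ i, Set (X.V i),
    Tendsto (fun i => ((Y i).ncard : ℝ) / (Nat.card (X.V i) : ℝ)) atTop (𝓝 1) ∧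
    HasSpectralGap (toMaxCstar (laplacian (core Y)))

open Classical in
/-- The proportion of the edges of a finite graph that lie in a subgraph, equal to `1` if
the graph has no edges. -/
noncomputable def edgeRatio {V : Type*} {G : SimpleGraph V} (H : G.Subgraph) : ℝ :=
  if G.edgeSet = ∅ then 1 else (H.edgeSet.ncard : ℝ) / (G.edgeSet.ncard : ℝ)

variable {X}

/-- Approximate isomorphism of box spaces. -/
def ApproxIso (X X' : BoxSpace.{u}) : Prop :=
  ∃ (Y : ∀ i, (X.graph i).Subgraph) (Y' : ∀ i, (X'.graph i).Subgraph),
    (∀ i, Nonempty ((Y i).coe ≃g (Y' i).coe)) ∧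
    Tendsto (fun i => ((Y i).verts.ncard : ℝ) / (Nat.card (X.V i) : ℝ)) atTop (𝓝 1) ∧
    Tendsto (fun i => ((Y' i).verts.ncard : ℝ) / (Nat.card (X'.V i) : ℝ)) atTop (𝓝 1) ∧
    Tendsto (fun i => edgeRatio (Y i)) atTop (𝓝 1) ∧
    Tendsto (fun i => edgeRatio (Y' i)) atTop (𝓝 1)

end BoxSpace

/-!
Let `H i ≅ H' i` be the isomorphic subgraphs and let `W i` be sets of vertices of `X'` witnessing
almost boundary (T). The witnesses for `X` are the sets `goodSet` of vertices `x` of `H i` such that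
`H i` contains all edges of `X` at `x`, `H' i` contains all edges of `X'` at the image of `x`, and
this image lies in `W i`. As degrees are bounded, the few edges outside the subgraphs touch few
vertices, and the good sets have density `1` (`tendsto_goodSet`).

The isomorphisms of the subgraphs glue to a map `φ : X → X'` which is a local isomorphism along the
good sets (`isLocalIso_glue`): if the `R`-ball of `x` is good, then `φ` maps it injectively onto the
`R`-ball of `φ x`. A non-principal ultrafilter lies in the core of the good sets iff it contains,
for every `R`, the set of all `x` whose `R`-ball is good. Hence `φ` induces an injective map from
this core to the core of `W`, and every arrow of `G(X')` at a point of the image lifts uniquely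
(`IsLocalIso.exists_lift_core`). Pulling back functions is therefore a unital *-homomorphism of
convolution algebras (`IsLocalIso.pullbackHom`). It maps the Laplace operator to the Laplace
operator, because `φ` preserves degrees and adjacency near points with good `1`-ball.

Unital *-homomorphisms of convolution algebras extend to the maximal C*-algebras, and unital
homomorphisms do not enlarge spectra, so the spectral gap passes from `X'` to `X`
(`HasSpectralGap.map`). The map from one core to the other need not be onto: only the pullback is
used.
-/

namespace BoxSpace

variable {X X' : BoxSpace.{u}}

/-! ### Functoriality of the spectral gap -/

/-- The pullback of a representation along a unital *-homomorphism. -/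
noncomputable def Rep.comap {Z : X.InvSet} {Z' : X'.InvSet} (Φ : ConvAlg Z' →⋆ₐ[ℂ] ConvAlg Z)
    (ρ : Rep Z) : Rep Z' where
  H := ρ.H
  π := ρ.π.comp Φ

/-- Reindexing of bounded families along the pullback of representations. On the images of the
convolution algebras under the universal representations it is `Φ`. -/
noncomputable def lpComap {Z : X.InvSet} {Z' : X'.InvSet} (Φ : ConvAlg Z' →⋆ₐ[ℂ] ConvAlg Z) :
    lp (fun ρ : Rep Z' => ρ.H →L[ℂ] ρ.H) ∞ →⋆ₐ[ℂ] lp (fun ρ : Rep Z => ρ.H →L[ℂ] ρ.H) ∞ where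
  toFun a := ⟨fun ρ => a (ρ.comap Φ), memℓp_infty ⟨‖a‖, by
    rintro _ ⟨ρ, rfl⟩
    exact lp.norm_apply_le_norm ENNReal.top_ne_zero a (ρ.comap Φ)⟩⟩
  map_one' := rfl
  map_mul' _ _ := rfl
  map_zero' := rfl
  map_add' _ _ := rfl
  commutes' _ := rfl
  map_star' _ := rfl

lemma continuous_lpComap {Z : X.InvSet} {Z' : X'.InvSet} (Φ : ConvAlg Z' →⋆ₐ[ℂ] ConvAlg Z) :
    Continuous (lpComap Φ) := by
  refine AddMonoidHomClass.continuous_of_bound (lpComap Φ) 1 fun a => ?_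
  rw [one_mul]
  exact lp.norm_le_of_forall_le (norm_nonneg a)
    fun ρ => lp.norm_apply_le_norm ENNReal.top_ne_zero a (ρ.comap Φ)

lemma lpComap_mem_maxCstar {Z : X.InvSet} {Z' : X'.InvSet} (Φ : ConvAlg Z' →⋆ₐ[ℂ] ConvAlg Z)
    {a : lp (fun ρ : Rep Z' => ρ.H →L[ℂ] ρ.H) ∞} (ha : a ∈ maxCstar Z') :
    lpComap Φ a ∈ maxCstar Z := by
  refine map_mem_closure (continuous_lpComap Φ) ha ?_
  rintro _ ⟨f, rfl⟩
  exact ⟨Φ f, rfl⟩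

lemma HasSpectralGap.map_starSubalgebra {A B : Type*} [Ring A] [StarRing A] [Algebra ℂ A]
    [StarModule ℂ A] [Ring B] [StarRing B] [Algebra ℂ B] [StarModule ℂ B]
    {S : StarSubalgebra ℂ A} {T : StarSubalgebra ℂ B} (Ψ : A →⋆ₐ[ℂ] B)
    (hΨ : ∀ a ∈ S, Ψ a ∈ T) {a : S} (h : HasSpectralGap a) :
    HasSpectralGap (⟨Ψ a, hΨ a a.2⟩ : T) := by
  obtain ⟨c, hc, hs⟩ := h
  let Θ : S →⋆ₐ[ℂ] T := (Ψ.comp S.subtype).codRestrict T fun a => hΨ a a.2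
  exact ⟨c, hc, (AlgHom.spectrum_apply_subset Θ a).trans hs⟩

/-- A unital *-homomorphism of convolution algebras extends to the maximal C*-algebras, and thus
can only shrink spectra. -/
lemma HasSpectralGap.map {Z : X.InvSet} {Z' : X'.InvSet} (Φ : ConvAlg Z' →⋆ₐ[ℂ] ConvAlg Z)
    {f : ConvAlg Z'} (h : HasSpectralGap (toMaxCstar f)) :
    HasSpectralGap (toMaxCstar (Φ f)) := by
  -- Fixing the closures and the element first spares the unifier a comparison of their algebra
  -- instances.
  have h1 := HasSpectralGap.map_starSubalgebra (S := maxCstar Z') (T := maxCstar Z) (lpComap Φ)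
    (fun _ => lpComap_mem_maxCstar Φ) (a := toMaxCstar f)
  exact h1 h

/-! ### Local isomorphisms between box spaces -/

/-- A map that is injective on a set `V` of vertices, carries the neighbours of every vertex of
`V` onto the neighbours of its image, and sends `V` into `W`. Outside `V` it is arbitrary. -/
structure IsLocalIso (φ : X.Pt → X'.Pt) (V : Set X.Pt) (W : Set X'.Pt) : Prop where
  injOn : InjOn φ V
  image_neighborSet : ∀ x ∈ V, φ '' X.total.neighborSet x = X'.total.neighborSet (φ x)
  mapsTo : MapsTo φ V W

lemma dist_le_succ_of_adj {x z y : X.Pt} {R : ℕ} (h : X.total.Adj x z) (h' : X.dist z y ≤ R) :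
    X.dist x y ≤ (R + 1 : ℕ) := by
  rw [add_comm]
  refine dist_add ?_ h'
  exact_mod_cast SimpleGraph.edist_le_one_iff_adj_or_eq.2 (Or.inl h)

lemma dist_self_le (x : X.Pt) (R : ℕ) : X.dist x x ≤ R := by
  rw [dist_self]
  exact zero_le

variable {φ : X.Pt → X'.Pt} {V : Set X.Pt} {W : Set X'.Pt}

/-- Paths that stay in `V` can be pushed forward. -/
lemma IsLocalIso.dist_map_le (hφ : IsLocalIso φ V W) {R : ℕ} {x y : X.Pt}
    (hx : ∀ z, X.dist x z ≤ R → z ∈ V) (h : X.dist x y ≤ R) : X'.dist (φ x) (φ y) ≤ R := by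
  induction R generalizing x with
  | zero =>
    obtain rfl : x = y := SimpleGraph.edist_eq_zero_iff.1 (nonpos_iff_eq_zero.1 h)
    exact dist_self_le _ _
  | succ R ih =>
    rcases exists_step h with rfl | ⟨z, hz, hzy⟩
    · exact dist_self_le _ _
    · refine dist_le_succ_of_adj ?_ (ih (fun w hw => hx w (dist_le_succ_of_adj hz hw)) hzy)
      have := mem_image_of_mem φ (show z ∈ X.total.neighborSet x from hz)
      rwa [hφ.image_neighborSet x (hx x (dist_self_le _ _))] at this

/-- Paths of length `R` from the image of a point whose `R`-ball lies in `V` can be lifted. -/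
lemma IsLocalIso.exists_lift (hφ : IsLocalIso φ V W) {R : ℕ} {x : X.Pt} {y' : X'.Pt}
    (hx : ∀ z, X.dist x z ≤ R → z ∈ V) (h : X'.dist (φ x) y' ≤ R) :
    ∃ y, X.dist x y ≤ R ∧ φ y = y' := by
  induction R generalizing x with
  | zero =>
    obtain rfl : φ x = y' := SimpleGraph.edist_eq_zero_iff.1 (nonpos_iff_eq_zero.1 h)
    exact ⟨x, dist_self_le _ _, rfl⟩
  | succ R ih =>
    rcases exists_step h with rfl | ⟨z', hz', hzy⟩
    · exact ⟨x, dist_self_le _ _, rfl⟩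
    · have h1 : z' ∈ X'.total.neighborSet (φ x) := hz'
      rw [← hφ.image_neighborSet x (hx x (dist_self_le _ _))] at h1
      obtain ⟨z, hz, rfl⟩ := h1
      obtain ⟨y, hy, rfl⟩ := ih (fun w hw => hx w (dist_le_succ_of_adj hz hw)) hzy
      exact ⟨y, dist_le_succ_of_adj hz hy, rfl⟩

lemma IsLocalIso.lapMatrix_map (hφ : IsLocalIso φ V W) {x y : X.Pt}
    (hx : ∀ z, X.dist x z ≤ (1 : ℕ) → z ∈ V) (h : X.dist x y ≤ (1 : ℕ)) :
    X'.lapMatrix (φ x) (φ y) = X.lapMatrix x y := by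
  have hxV := hx x (dist_self_le _ _)
  have hN : X.total.neighborSet x ⊆ V := fun z hz =>
    hx z (dist_le_succ_of_adj (R := 0) hz (dist_self_le _ _))
  have h1 : φ x = φ y ↔ x = y := hφ.injOn.eq_iff hxV (hx y h)
  have h2 : X'.total.Adj (φ x) (φ y) ↔ X.total.Adj x y := by
    rw [← SimpleGraph.mem_neighborSet, ← hφ.image_neighborSet x hxV,
      hφ.injOn.mem_image_iff hN (hx y h), SimpleGraph.mem_neighborSet]
  have h3 : (X'.total.neighborSet (φ x)).ncard = (X.total.neighborSet x).ncard := by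
    rw [← hφ.image_neighborSet x hxV, (hφ.injOn.mono hN).ncard_image]
  rw [lapMatrix, lapMatrix, h3]
  by_cases h4 : x = y
  · rw [if_pos h4, if_pos (h1.2 h4)]
  · rw [if_neg h4, if_neg (h1.not.2 h4)]
    by_cases h5 : X.total.Adj x y
    · rw [if_pos h5, if_pos (h2.2 h5)]
    · rw [if_neg h5, if_neg (h2.not.2 h5)]

/-! ### The induced map of cores -/

/-- The core consists of the non-principal ultrafilters which, for every `R`, contain the set of
points whose `R`-ball lies in `Y`. -/
lemma mem_core {Y : ∀ i, Set (X.V i)} {ω : X.StoneCech} : ω ∈ (core Y).carrier ↔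
    ω ∉ range (pure : X.Pt → X.StoneCech) ∧
      ∀ R : ℕ, {x | ∀ y, X.dist x y ≤ R → y ∈ X.union Y} ∈ ω := by
  have key : ∀ R : ℕ, {x | ∀ y, X.dist x y ≤ R → y ∈ X.union Y} =
      {x | ∃ y ∈ (X.union Y)ᶜ, X.dist x y ≤ R}ᶜ := by
    intro R
    ext x
    simp only [mem_compl_iff, mem_ofPred_eq, not_exists, not_and]
    exact forall_congr' fun y => by tauto
  simp only [key, Ultrafilter.compl_mem_iff_notMem]
  change ω ∈ X.boundary univ \ X.sat (X.boundary (X.union Y)ᶜ) ↔ _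
  rw [Set.mem_sdiff, mem_boundary]
  constructor
  · rintro ⟨⟨-, h1⟩, h2⟩
    rw [mem_sat_boundary h1] at h2
    exact ⟨h1, not_exists.1 h2⟩
  · rintro ⟨h1, h2⟩
    rw [mem_sat_boundary h1]
    exact ⟨⟨univ_mem, h1⟩, not_exists.2 h2⟩

lemma union_mem_of_mem_core {Y : ∀ i, Set (X.V i)} {ω : X.StoneCech}
    (hω : ω ∈ (core Y).carrier) : X.union Y ∈ ω :=
  mem_of_superset ((mem_core.1 hω).2 0) fun x hx => hx x (dist_self_le _ _)

lemma map_injOn_of_injOn {α β : Type*} {f : α → β} {s : Set α} (hf : InjOn f s) :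
    InjOn (Ultrafilter.map f) {U : Ultrafilter α | s ∈ U} := by
  intro U hU U' hU' h
  refine (Ultrafilter.eq_of_le fun t ht => ?_).symm
  have h1 : f '' (t ∩ s) ∈ U'.map f := by
    rw [← h, Ultrafilter.mem_map]
    filter_upwards [ht, hU] with x hx hxs using mem_image_of_mem f ⟨hx, hxs⟩
  filter_upwards [Ultrafilter.mem_map.1 h1, hU'] with x hx hxs
  exact ((hf.mem_image_iff inter_subset_right hxs).1 hx).1

variable {Y : ∀ i, Set (X.V i)} {Y' : ∀ i, Set (X'.V i)}

lemma IsLocalIso.injOn_core (hφ : IsLocalIso φ (X.union Y) (X'.union Y')) :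
    InjOn (Ultrafilter.map φ) (core Y).carrier :=
  (map_injOn_of_injOn hφ.injOn).mono fun _ => union_mem_of_mem_core

lemma IsLocalIso.map_mem_core (hφ : IsLocalIso φ (X.union Y) (X'.union Y')) {ω : X.StoneCech}
    (hω : ω ∈ (core Y).carrier) : ω.map φ ∈ (core Y').carrier := by
  refine mem_core.2 ⟨?_, fun R => ?_⟩
  · -- The fibre of `φ` in the union of the `Y i` has at most one point.
    rintro ⟨p, hp⟩
    have h1 : {p} ∈ ω.map φ := hp ▸ mem_singleton p
    have h2 := inter_mem (Ultrafilter.mem_map.1 h1) (union_mem_of_mem_core hω)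
    have hsub : (φ ⁻¹' {p} ∩ X.union Y).Subsingleton := fun x hx y hy =>
      hφ.injOn hx.2 hy.2 (hx.1.trans hy.1.symm)
    obtain ⟨x, -, hx⟩ := Ultrafilter.eq_pure_of_finite_mem hsub.finite h2
    exact (mem_core.1 hω).1 ⟨x, hx.symm⟩
  · rw [Ultrafilter.mem_map]
    filter_upwards [(mem_core.1 hω).2 R] with x hx y' hy'
    obtain ⟨y, hy, rfl⟩ := hφ.exists_lift hx hy'
    exact hφ.mapsTo (hx y hy)

lemma IsLocalIso.entourage_mem_map (hφ : IsLocalIso φ (X.union Y) (X'.union Y')) {R : ℕ}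
    {U : Ultrafilter (X.Pt × X.Pt)} (hU : X.entourage R ∈ U)
    (h : U.map Prod.fst ∈ (core Y).carrier) : X'.entourage R ∈ U.map (Prod.map φ φ) := by
  rw [Ultrafilter.mem_map]
  filter_upwards [hU, Ultrafilter.mem_map.1 ((mem_core.1 h).2 R)] with p hp hp'
  exact hφ.dist_map_le hp' hp

/-- The arrows of `G(X')` at a point of the image of the core lift to arrows of `G(X)`. By
injectivity on the core, the lift is unique. -/
lemma IsLocalIso.exists_lift_core (hφ : IsLocalIso φ (X.union Y) (X'.union Y')) {R : ℕ}
    {ω : X.StoneCech} {η' : X'.StoneCech} (hω : ω ∈ (core Y).carrier)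
    (h : (ω.map φ, η') ∈ X'.entClosure R) :
    ∃ η ∈ (core Y).carrier, (ω, η) ∈ X.entClosure R ∧ η.map φ = η' := by
  -- Near `ω.map φ`, the arrow is given by a map of displacement at most `R`; this map is lifted
  -- pointwise.
  obtain ⟨σ⟩ := exists_sections X' R
  obtain ⟨b, hb⟩ := σ.exists_col η'
  rw [σ.eq_of_mem h hb]
  have hlift : ∀ x, ∃ y, X.dist x y ≤ R ∧
      ((∀ z, X.dist x z ≤ R → z ∈ X.union Y) → φ y = σ.t b (φ x)) := by
    intro x
    by_cases hx : ∀ z, X.dist x z ≤ R → z ∈ X.union Y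
    · obtain ⟨y, hy, hy'⟩ := hφ.exists_lift hx (σ.near b (φ x))
      exact ⟨y, hy, fun _ => hy'⟩
    · exact ⟨x, dist_self_le _ _, fun h => absurd h hx⟩
  choose t ht ht' using hlift
  have hmem : (ω, ω.map t) ∈ X.entClosure R := by
    refine mem_entClosure.2 ⟨ω.map fun x => (x, t x), BoxSpace.entourage_mem_map ht, ?_⟩
    exact Prod.ext (by simp only [proj, Ultrafilter.map_map]; exact ω.map_id)
      (by simp only [proj, Ultrafilter.map_map]; rfl)
  refine ⟨ω.map t, ((core Y).inv hmem).2 hω, hmem, ?_⟩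
  rw [Ultrafilter.map_map, Ultrafilter.map_map]
  apply Ultrafilter.coe_injective
  rw [Ultrafilter.coe_map, Ultrafilter.coe_map]
  apply Filter.map_congr
  filter_upwards [(mem_core.1 hω).2 R] with x hx using ht' x hx

lemma IsLocalIso.entClosure_of_map (hφ : IsLocalIso φ (X.union Y) (X'.union Y')) {R : ℕ}
    {ω η : X.StoneCech} (hω : ω ∈ (core Y).carrier) (hη : η ∈ (core Y).carrier)
    (h : (ω.map φ, η.map φ) ∈ X'.entClosure R) : (ω, η) ∈ X.entClosure R := by
  obtain ⟨η₁, hη₁, h1, h2⟩ := hφ.exists_lift_core hω h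
  rwa [← hφ.injOn_core hη₁ hη h2]

lemma IsLocalIso.lapExt_map (hφ : IsLocalIso φ (X.union Y) (X'.union Y'))
    {ω η : X.StoneCech} (hω : ω ∈ (core Y).carrier) (hη : η ∈ (core Y).carrier) :
    X'.lapExt (ω.map φ) (η.map φ) = X.lapExt ω η := by
  by_cases h : (ω, η) ∈ X.entClosure 1
  · obtain ⟨U, hU, hp⟩ := mem_entClosure.1 h
    obtain ⟨rfl, rfl⟩ := Prod.mk.inj hp
    obtain ⟨c, hc⟩ := lapMatrix_eventually U
    have hc' : {p : X'.Pt × X'.Pt | X'.lapMatrix p.1 p.2 = c} ∈ U.map (Prod.map φ φ) := by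
      rw [Ultrafilter.mem_map]
      filter_upwards [hU, hc, Ultrafilter.mem_map.1 ((mem_core.1 hω).2 1)] with p hp hpc hp'
      exact (hφ.lapMatrix_map hp' hp).trans hpc
    have h1 := lapExt_eq (hφ.entourage_mem_map hU hω) hc'
    rw [lapExt_eq hU hc, ← h1]
    simp only [Ultrafilter.map_map]
    rfl
  · rw [lapExt, lapExt, if_neg h, if_neg fun h' => h (hφ.entClosure_of_map hω hη h')]

/-! ### The pullback of functions on the groupoids -/

open Classical in
/-- The pullback of a function on `βX' × βX'`, cut off to the core. -/
noncomputable def pullback (φ : X.Pt → X'.Pt) (Y : ∀ i, Set (X.V i))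
    (F : X'.StoneCech → X'.StoneCech → ℂ) (ω η : X.StoneCech) : ℂ :=
  if ω ∈ (core Y).carrier ∧ η ∈ (core Y).carrier then F (ω.map φ) (η.map φ) else 0

lemma pullback_of_mem {F : X'.StoneCech → X'.StoneCech → ℂ} {ω η : X.StoneCech}
    (hω : ω ∈ (core Y).carrier) (hη : η ∈ (core Y).carrier) :
    pullback φ Y F ω η = F (ω.map φ) (η.map φ) := if_pos ⟨hω, hη⟩

lemma IsLocalIso.isCc_pullback (hφ : IsLocalIso φ (X.union Y) (X'.union Y'))
    {F : X'.StoneCech → X'.StoneCech → ℂ} (hF : IsCc (core Y') F) :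
    IsCc (core Y) (pullback φ Y F) := by
  constructor
  · obtain ⟨R, hR⟩ := hF.supp
    refine ⟨R, fun ω η h => ?_⟩
    rw [pullback] at h
    split_ifs at h with h'
    · exact ⟨h'.1, h'.2, hφ.entClosure_of_map h'.1 h'.2 (hR _ _ h).2.2⟩
    · exact absurd rfl h
  · intro R
    have h1 := (hF.cont R).comp (continuous_umap (Prod.map φ φ)).continuousOn
      (s := band (core Y) R) fun U hU => by
        refine ⟨hφ.entourage_mem_map hU.1 hU.2.1, ?_, ?_⟩
        · have := hφ.map_mem_core hU.2.1
          rwa [Ultrafilter.map_map] at this ⊢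
        · have := hφ.map_mem_core hU.2.2
          rwa [Ultrafilter.map_map] at this ⊢
    refine h1.congr fun U hU => ?_
    rw [pullback_of_mem hU.2.1 hU.2.2]
    simp only [Function.comp_apply, Ultrafilter.map_map]
    rfl

/-- The pullback is multiplicative: by injectivity on the core and lifting of arrows, the nonzero
terms of the two convolution sums correspond to each other. -/
lemma IsLocalIso.pullback_conv (hφ : IsLocalIso φ (X.union Y) (X'.union Y'))
    {F G : X'.StoneCech → X'.StoneCech → ℂ} (hF : IsCc (core Y') F) :
    pullback φ Y (conv F G) = conv (pullback φ Y F) (pullback φ Y G) := by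
  funext ω η
  by_cases h : ω ∈ (core Y).carrier ∧ η ∈ (core Y).carrier
  · obtain ⟨hω, hη⟩ := h
    obtain ⟨R, hR⟩ := hF.supp
    have hsub : ∀ {α : Type u} {f : α → ℂ} {s : Set α}, Function.support f ⊆ s →
        ∑ᶠ a, f a = ∑ᶠ a ∈ s, f a := fun h => by
      rw [finsum_mem_def, indicator_eq_self.2 h]
    have hF' : Function.support (fun ζ' => F (ω.map φ) ζ' * G ζ' (η.map φ)) ⊆
        Ultrafilter.map φ '' (core Y).carrier := by
      intro ζ' hζ'
      obtain ⟨ζ, hζ, -, h⟩ :=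
        hφ.exists_lift_core hω (hR _ _ (left_ne_zero_of_mul hζ')).2.2
      exact ⟨ζ, hζ, h⟩
    have hG' : Function.support (fun ζ => pullback φ Y F ω ζ * pullback φ Y G ζ η) ⊆
        (core Y).carrier := by
      intro ζ hζ
      by_contra hcon
      exact hζ (by simp only [pullback, hcon, and_false, if_false, zero_mul])
    rw [pullback_of_mem hω hη, conv, conv, hsub hF', finsum_mem_image hφ.injOn_core, hsub hG']
    refine finsum_mem_congr rfl fun ζ hζ => ?_
    rw [pullback_of_mem hω hζ, pullback_of_mem hζ hη]
  · rw [pullback, if_neg h, conv, finsum_eq_zero_of_forall_eq_zero]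
    intro ζ
    rcases not_and_or.1 h with h | h <;> simp [pullback, h]

lemma IsLocalIso.pullback_one (hφ : IsLocalIso φ (X.union Y) (X'.union Y')) :
    pullback φ Y (diag (core Y') fun _ => 1) = diag (core Y) fun _ => 1 := by
  funext ω η
  rw [pullback, diag, diag]
  by_cases h : ω ∈ (core Y).carrier ∧ η ∈ (core Y).carrier
  · rw [if_pos h]
    by_cases h' : ω = η
    · rw [if_pos ⟨congrArg _ h', hφ.map_mem_core h.1⟩, if_pos ⟨h', h.1⟩]
    · rw [if_neg fun h1 => h' (hφ.injOn_core h.1 h.2 h1.1), if_neg fun h1 => h' h1.1]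
  · rw [if_neg h, if_neg]
    rintro ⟨rfl, h1⟩
    exact h ⟨h1, h1⟩

/-- The pullback of `C_c`-functions is a unital *-homomorphism of convolution algebras. -/
noncomputable def IsLocalIso.pullbackHom (hφ : IsLocalIso φ (X.union Y) (X'.union Y')) :
    ConvAlg (core Y') →⋆ₐ[ℂ] ConvAlg (core Y) where
  toFun f := ConvAlg.mk _ (hφ.isCc_pullback f.isCc)
  map_one' := by
    apply ConvAlg.ext_injective
    rw [ConvAlg.ext_mk, ConvAlg.ext_one, ConvAlg.ext_one, hφ.pullback_one]
  map_mul' f g := by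
    apply ConvAlg.ext_injective
    rw [ConvAlg.ext_mk, ConvAlg.ext_mul, ConvAlg.ext_mul, ConvAlg.ext_mk, ConvAlg.ext_mk,
      hφ.pullback_conv f.isCc]
  map_zero' := by
    apply ConvAlg.ext_injective
    rw [ConvAlg.ext_mk, ConvAlg.ext_zero, ConvAlg.ext_zero]
    funext ω η
    simp [pullback]
  map_add' f g := by
    apply ConvAlg.ext_injective
    rw [ConvAlg.ext_mk, ConvAlg.ext_add, ConvAlg.ext_add, ConvAlg.ext_mk, ConvAlg.ext_mk]
    funext ω η
    simp only [pullback, Pi.add_apply]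
    split_ifs <;> simp
  commutes' c := by
    apply ConvAlg.ext_injective
    rw [ConvAlg.ext_mk, Algebra.algebraMap_eq_smul_one, Algebra.algebraMap_eq_smul_one,
      ConvAlg.ext_smul, ConvAlg.ext_smul, ConvAlg.ext_one, ConvAlg.ext_one, ← hφ.pullback_one]
    funext ω η
    simp only [pullback, Pi.smul_apply]
    split_ifs <;> simp
  map_star' f := by
    apply ConvAlg.ext_injective
    rw [ConvAlg.ext_mk, ConvAlg.ext_star, ConvAlg.ext_star, ConvAlg.ext_mk]
    funext ω η
    rw [invol]
    by_cases h : ω ∈ (core Y).carrier ∧ η ∈ (core Y).carrier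
    · rw [pullback_of_mem h.1 h.2, pullback_of_mem h.2 h.1, invol]
    · rw [pullback, pullback, if_neg h, if_neg fun h' => h h'.symm, star_zero]

lemma IsLocalIso.pullbackHom_laplacian (hφ : IsLocalIso φ (X.union Y) (X'.union Y')) :
    hφ.pullbackHom (laplacian (core Y')) = laplacian (core Y) := by
  apply ConvAlg.ext_injective
  change (ConvAlg.mk _ (hφ.isCc_pullback (laplacian (core Y')).isCc)).ext = _
  rw [ConvAlg.ext_mk, laplacian, ConvAlg.ext_mk, laplacian, ConvAlg.ext_mk]
  funext ω η
  by_cases h : ω ∈ (core Y).carrier ∧ η ∈ (core Y).carrier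
  · rw [pullback_of_mem h.1 h.2, if_pos h, if_pos ⟨hφ.map_mem_core h.1, hφ.map_mem_core h.2⟩,
      hφ.lapExt_map h.1 h.2]
  · rw [pullback, if_neg h, if_neg h]

/-! ### Counting vertices at missing edges -/

/-- The vertices at which a subgraph misses an edge of the ambient graph. -/
def defectSet {V : Type*} {G : SimpleGraph V} (H : G.Subgraph) : Set V :=
  {x | ∃ y, G.Adj x y ∧ ¬ H.Adj x y}

section Counting

variable {V : Type*} [Finite V] {G : SimpleGraph V}

lemma ncard_defectSet_le (H : G.Subgraph) :
    (defectSet H).ncard ≤ (G.edgeSet \ H.edgeSet).ncard * 2 := by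
  have hfin : (G.edgeSet \ H.edgeSet).Finite := toFinite _
  have hsub : defectSet H ⊆ ⋃ e ∈ hfin.toFinset, {x | x ∈ e} := by
    rintro x ⟨y, hG, hH⟩
    simp only [mem_iUnion]
    exact ⟨s(x, y), by simpa using ⟨hG, hH⟩, Sym2.mem_mk_left x y⟩
  refine (ncard_le_ncard hsub (toFinite _)).trans ((Finset.set_ncard_biUnion_le _ _).trans ?_)
  rw [ncard_eq_toFinset_card _ hfin, ← smul_eq_mul]
  refine Finset.sum_le_card_nsmul _ _ 2 fun e _ => ?_
  induction e using Sym2.ind with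
  | _ a b =>
    have : {x | x ∈ s(a, b)} = {a, b} := by
      ext x
      simp
    rw [this]
    exact (ncard_insert_le a {b}).trans (by rw [ncard_singleton])

lemma ncard_edgeSet_le {d : ℕ} (hd : ∀ x, (G.neighborSet x).ncard ≤ d) :
    G.edgeSet.ncard ≤ Nat.card V * d := by
  have := Fintype.ofFinite V
  have hsub : G.edgeSet ⊆ ⋃ x ∈ (Finset.univ : Finset V),
      (fun y => s(x, y)) '' G.neighborSet x := by
    intro e he
    induction e using Sym2.ind with
    | _ a b =>
      simp only [mem_iUnion]
      exact ⟨a, Finset.mem_univ a, b, he, rfl⟩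
  refine (ncard_le_ncard hsub (toFinite _)).trans ((Finset.set_ncard_biUnion_le _ _).trans ?_)
  rw [Nat.card_eq_fintype_card, ← smul_eq_mul]
  exact Finset.sum_le_card_nsmul _ _ d fun x _ => (ncard_image_le (toFinite _)).trans (hd x)

lemma ncard_edgeSet_subgraph_le (H : G.Subgraph) : H.edgeSet.ncard ≤ G.edgeSet.ncard :=
  ncard_le_ncard H.edgeSet_subset (toFinite _)

lemma edgeRatio_le_one (H : G.Subgraph) : edgeRatio H ≤ 1 := by
  rw [edgeRatio]
  split_ifs
  · exact le_rfl
  · exact div_le_one_of_le₀ (by exact_mod_cast ncard_edgeSet_subgraph_le H) (Nat.cast_nonneg _)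

lemma ncard_edgeSet_sdiff (H : G.Subgraph) :
    ((G.edgeSet \ H.edgeSet).ncard : ℝ) = G.edgeSet.ncard * (1 - edgeRatio H) := by
  have h1 : ((G.edgeSet \ H.edgeSet).ncard : ℝ) = G.edgeSet.ncard - H.edgeSet.ncard := by
    rw [ncard_sdiff H.edgeSet_subset (toFinite _), Nat.cast_sub (ncard_edgeSet_subgraph_le H)]
  rw [edgeRatio]
  split_ifs with h
  · simp [h]
  · have h2 : (G.edgeSet.ncard : ℝ) ≠ 0 := by
      rw [Nat.cast_ne_zero, Ne, ncard_eq_zero (toFinite _)]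
      exact h
    rw [h1]
    field_simp

/-- In a graph of degree at most `d`, the number of edges is linear in the number of vertices, so
few missing edges touch few vertices. -/
lemma ncard_defectSet_le_card_mul {d : ℕ} (hd : ∀ x, (G.neighborSet x).ncard ≤ d)
    (H : G.Subgraph) :
    ((defectSet H).ncard : ℝ) ≤ Nat.card V * (2 * d * (1 - edgeRatio H)) := by
  have h1 : ((defectSet H).ncard : ℝ) ≤ (G.edgeSet \ H.edgeSet).ncard * 2 := by
    exact_mod_cast ncard_defectSet_le H
  have h2 : (G.edgeSet.ncard : ℝ) ≤ Nat.card V * d := by exact_mod_cast ncard_edgeSet_le hd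
  rw [ncard_edgeSet_sdiff] at h1
  have h3 := mul_le_mul_of_nonneg_right h2 (sub_nonneg.2 (edgeRatio_le_one H))
  linarith

variable {V' : Type*} [Finite V'] {G' : SimpleGraph V'} {H : G.Subgraph} {H' : G'.Subgraph}

/-- The vertices of `H` at which neither `H` nor, after applying `e`, `H'` misses an edge, and
which `e` maps into `W`. -/
def goodSet (e : H.coe ≃g H'.coe) (W : Set V') : Set V :=
  {x | ∃ h : x ∈ H.verts, x ∉ defectSet H ∧ (e ⟨x, h⟩ : V') ∉ defectSet H' ∧ (e ⟨x, h⟩ : V') ∈ W}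

lemma ncard_compl_goodSet_le (e : H.coe ≃g H'.coe) (W : Set V') :
    (goodSet e W)ᶜ.ncard ≤
      H.vertsᶜ.ncard + (defectSet H).ncard + ((defectSet H').ncard + Wᶜ.ncard) := by
  let B : Set V' := defectSet H' ∪ Wᶜ
  let T : Set H'.verts := Subtype.val ⁻¹' B
  have hsub : (goodSet e W)ᶜ ⊆
      (H.vertsᶜ ∪ defectSet H) ∪ (fun b : H'.verts => (e.symm b : V)) '' T := by
    intro x hx
    by_contra hcon
    simp only [mem_union, not_or, mem_compl_iff, not_not] at hcon
    obtain ⟨⟨h1, h2⟩, h3⟩ := hcon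
    refine hx ⟨h1, h2, ?_⟩
    have h4 : (e ⟨x, h1⟩ : V') ∉ B := fun h => h3 ⟨e ⟨x, h1⟩, h, by simp⟩
    simpa [B, not_or] using h4
  have hT : T.ncard ≤ B.ncard := by
    rw [← ncard_image_of_injective T Subtype.val_injective]
    exact ncard_le_ncard (image_preimage_subset _ _) (toFinite _)
  calc (goodSet e W)ᶜ.ncard ≤ _ := ncard_le_ncard hsub (toFinite _)
    _ ≤ _ := ncard_union_le _ _
    _ ≤ _ := add_le_add (ncard_union_le _ _)
      ((ncard_image_le (toFinite _)).trans (hT.trans (ncard_union_le _ _)))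

lemma ncard_compl_eq (s : Set V) : (sᶜ.ncard : ℝ) = Nat.card V - s.ncard := by
  rw [ncard_compl s (toFinite _), Nat.cast_sub (ncard_le_card s)]

end Counting

lemma card_pos_eventually (X : BoxSpace.{u}) : ∀ᶠ i in atTop, (0 : ℝ) < Nat.card (X.V i) := by
  filter_upwards [X.card_tendsto.eventually_gt_atTop 0] with i hi
  exact_mod_cast hi

lemma tendsto_goodSet {H : ∀ i, (X.graph i).Subgraph} {H' : ∀ i, (X'.graph i).Subgraph}
    (e : ∀ i, (H i).coe ≃g (H' i).coe) {W : ∀ i, Set (X'.V i)}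
    (hH : Tendsto (fun i => ((H i).verts.ncard : ℝ) / (Nat.card (X.V i) : ℝ)) atTop (𝓝 1))
    (hH' : Tendsto (fun i => ((H' i).verts.ncard : ℝ) / (Nat.card (X'.V i) : ℝ)) atTop (𝓝 1))
    (hE : Tendsto (fun i => edgeRatio (H i)) atTop (𝓝 1))
    (hE' : Tendsto (fun i => edgeRatio (H' i)) atTop (𝓝 1))
    (hW : Tendsto (fun i => ((W i).ncard : ℝ) / (Nat.card (X'.V i) : ℝ)) atTop (𝓝 1)) :
    Tendsto (fun i => ((goodSet (e i) (W i)).ncard : ℝ) / (Nat.card (X.V i) : ℝ)) atTop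
      (𝓝 1) := by
  have := X.finite
  have := X'.finite
  obtain ⟨d, hd⟩ := X.bounded_degree
  obtain ⟨d', hd'⟩ := X'.bounded_degree
  have hcard : ∀ i, (H' i).verts.ncard = (H i).verts.ncard := fun i =>
    (Nat.card_congr (e i).toEquiv).symm
  -- The isomorphic subgraphs are asymptotically everything on both sides, so the two sequences
  -- of cardinalities are asymptotically equal.
  have hratio : Tendsto (fun i => (Nat.card (X'.V i) : ℝ) / (Nat.card (X.V i) : ℝ)) atTop
      (𝓝 1) := by
    have h1 := hH.div hH' one_ne_zero
    rw [div_one] at h1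
    refine h1.congr' ?_
    filter_upwards [hH.eventually_ne one_ne_zero, card_pos_eventually X,
      card_pos_eventually X'] with i hi h2 h3
    have h4 : ((H i).verts.ncard : ℝ) ≠ 0 := fun h => hi (by rw [h, zero_div])
    simp only [Pi.div_apply, hcard]
    field_simp
  have hlim : Tendsto (fun i => 1 - ((1 - ((H i).verts.ncard : ℝ) / (Nat.card (X.V i) : ℝ)) +
      2 * d * (1 - edgeRatio (H i)) + (Nat.card (X'.V i) : ℝ) / (Nat.card (X.V i) : ℝ) *
        (2 * d' * (1 - edgeRatio (H' i)) +
          (1 - ((W i).ncard : ℝ) / (Nat.card (X'.V i) : ℝ))))) atTop (𝓝 1) := by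
    have h1 := ((hH.const_sub 1).add ((hE.const_sub 1).const_mul (2 * (d : ℝ)))).add
      (hratio.mul (((hE'.const_sub 1).const_mul (2 * (d' : ℝ))).add (hW.const_sub 1)))
    simpa using h1.const_sub 1
  refine tendsto_of_tendsto_of_tendsto_of_le_of_le' hlim tendsto_const_nhds ?_ ?_
  · filter_upwards [card_pos_eventually X, card_pos_eventually X'] with i h2 h3
    have h4 : ((goodSet (e i) (W i))ᶜ.ncard : ℝ) ≤ (H i).vertsᶜ.ncard + (defectSet (H i)).ncard +
        ((defectSet (H' i)).ncard + (W i)ᶜ.ncard) := by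
      exact_mod_cast ncard_compl_goodSet_le (e i) (W i)
    rw [ncard_compl_eq, ncard_compl_eq, ncard_compl_eq] at h4
    have h5 := ncard_defectSet_le_card_mul (hd i) (H i)
    have h6 := ncard_defectSet_le_card_mul (hd' i) (H' i)
    rw [le_div_iff₀ h2]
    have h7 : (1 - ((1 - ((H i).verts.ncard : ℝ) / (Nat.card (X.V i) : ℝ)) +
      2 * d * (1 - edgeRatio (H i)) + (Nat.card (X'.V i) : ℝ) / (Nat.card (X.V i) : ℝ) *
        (2 * d' * (1 - edgeRatio (H' i)) +
          (1 - ((W i).ncard : ℝ) / (Nat.card (X'.V i) : ℝ))))) * (Nat.card (X.V i) : ℝ) =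
      (H i).verts.ncard - Nat.card (X.V i) * (2 * d * (1 - edgeRatio (H i))) -
        Nat.card (X'.V i) * (2 * d' * (1 - edgeRatio (H' i))) -
        (Nat.card (X'.V i) - (W i).ncard) := by
      field_simp
      ring
    rw [h7]
    linarith
  · filter_upwards with i
    exact div_le_one_of_le₀ (by exact_mod_cast ncard_le_card _) (Nat.cast_nonneg _)

/-! ### Gluing the isomorphisms of the subgraphs -/

open Classical in
/-- The isomorphisms of the subgraphs, glued to a map of the box spaces that is constant off the
subgraphs. -/
noncomputable def glue [Nonempty X'.Pt] {H : ∀ i, (X.graph i).Subgraph}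
    {H' : ∀ i, (X'.graph i).Subgraph} (e : ∀ i, (H i).coe ≃g (H' i).coe) (p : X.Pt) : X'.Pt :=
  if h : p.2 ∈ (H p.1).verts then ⟨p.1, (e p.1 ⟨p.2, h⟩ : X'.V p.1)⟩ else Classical.arbitrary _

lemma glue_mk [Nonempty X'.Pt] {H : ∀ i, (X.graph i).Subgraph} {H' : ∀ i, (X'.graph i).Subgraph}
    (e : ∀ i, (H i).coe ≃g (H' i).coe) {i : ℕ} {x : X.V i} (h : x ∈ (H i).verts) :
    glue e ⟨i, x⟩ = ⟨i, (e i ⟨x, h⟩ : X'.V i)⟩ := dif_pos h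

lemma isLocalIso_glue [Nonempty X'.Pt] {H : ∀ i, (X.graph i).Subgraph}
    {H' : ∀ i, (X'.graph i).Subgraph} (e : ∀ i, (H i).coe ≃g (H' i).coe)
    (W : ∀ i, Set (X'.V i)) :
    IsLocalIso (glue e) (X.union fun i => goodSet (e i) (W i)) (X'.union W) := by
  constructor
  · rintro ⟨i, x⟩ ⟨hx, -⟩ ⟨j, y⟩ ⟨hy, -⟩ h
    rw [glue_mk e hx, glue_mk e hy] at h
    obtain ⟨rfl, h⟩ := Sigma.mk.inj_iff.1 h
    have := congrArg Subtype.val ((e i).injective (Subtype.ext (eq_of_heq h)))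
    exact congrArg _ this
  · rintro ⟨i, x⟩ ⟨hx, h1, h2, -⟩
    have h1' : ∀ y, (X.graph i).Adj x y → (H i).Adj x y := fun y hy => by
      by_contra h
      exact h1 ⟨y, hy, h⟩
    have h2' : ∀ y, (X'.graph i).Adj (e i ⟨x, hx⟩) y → (H' i).Adj (e i ⟨x, hx⟩) y :=
      fun y hy => by
        by_contra h
        exact h2 ⟨y, hy, h⟩
    ext q
    simp only [mem_image, SimpleGraph.mem_neighborSet]
    rw [glue_mk e hx, adj_iff]
    constructor
    · rintro ⟨p, hp, rfl⟩
      obtain ⟨y, rfl, hy⟩ := (adj_iff i x p).1 hp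
      have hyv := (h1' y hy).snd_mem
      refine ⟨_, glue_mk e hyv, ?_⟩
      have : (H' i).coe.Adj (e i ⟨x, hx⟩) (e i ⟨y, hyv⟩) :=
        (e i).map_adj_iff.2 (by simpa using h1' y hy)
      exact ((H' i).coe_adj_sub _ _ this)
    · rintro ⟨y', rfl, hy'⟩
      have hyv := (h2' y' hy').snd_mem
      refine ⟨⟨i, ((e i).symm ⟨y', hyv⟩ : X.V i)⟩, ?_, ?_⟩
      · rw [adj_iff]
        refine ⟨_, rfl, (H i).coe_adj_sub ⟨x, hx⟩ _ ?_⟩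
        rw [← (e i).map_adj_iff]
        simpa using h2' y' hy'
      · rw [glue_mk e ((e i).symm ⟨y', hyv⟩).2]
        simp
  · rintro ⟨i, x⟩ ⟨hx, -, -, h3⟩
    rw [glue_mk e hx]
    exact h3

end BoxSpace

/-- Almost boundary property (T) is invariant under approximate isomorphism of box spaces. -/
theorem proposition2p12 (X X' : BoxSpace.{u}) (h : BoxSpace.ApproxIso X X')
    (hT : X'.AlmostBoundaryT) : X.AlmostBoundaryT := by
  obtain ⟨H, H', he, hH, hH', hE, hE'⟩ := h
  obtain ⟨W, hW, hgap⟩ := hT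
  have : Nonempty X'.Pt := by
    obtain ⟨i, hi⟩ := (X'.card_tendsto.eventually_gt_atTop 0).exists
    obtain ⟨⟨x⟩, -⟩ := Nat.card_pos_iff.1 hi
    exact ⟨⟨i, x⟩⟩
  let e : ∀ i, (H i).coe ≃g (H' i).coe := fun i => (he i).some
  refine ⟨fun i => BoxSpace.goodSet (e i) (W i),
    BoxSpace.tendsto_goodSet e hH hH' hE hE' hW, ?_⟩
  rw [← (BoxSpace.isLocalIso_glue e W).pullbackHom_laplacian]
  exact hgap.map _
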